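/- **Model.** Fix an integer $K\ge 2$ and constants $A,B,\tau>0$ with $KA\le B<1$ and $\tau\le(1-B)/K$. For each $u\in\mathcal A$ let $S_1(u),\dots,S_K(u)$ be similarities of $[0,1]$ into itself with ratios $a(i,u)$ such that $A\le a(i,u)$, $\sum_i a(i,u)\le B$ and $\operatorname{dist}(S_i(u)[0,1],S_j(u)[0,1])\ge\tau$ for $i\ne j$. For each $v\in\mathcal W$ let $(p(1,v),\dots,p(K,v))$ be a probability vector. Assume $a(i,\cdot)$ and $p(i,\cdot)$ are measurable, let $\mathbb P$ be a probability measure on $\Lambda=\mathcal A\times\mathcal W$, and assume that for some $s>0$, $\mathbb E(p(i,\lambda)^{-s})<\infty$ for all $i$ (for $\lambda=(u,v)$ write $a(i,\lambda)=a(i,u)$, $p(i,\lambda)=p(i,v)$). Choose $\boldsymbol\lambda=(\lambda_n)_{n\ge1}\in\Lambda^{\mathbb N}$ according to $\mathbb P^{\mathbb N}$, put $I_{i_1\dots i_n}(\boldsymbol\lambda)=S_{i_1}(\lambda_1)\circ\dots\circ S_{i_n}(\lambda_n)[0,1]$, and let $\mu_{\boldsymbol\lambda}$ be the Borel probability measure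 on $[0,1]$ with $\mu_{\boldsymbol\lambda}(I_{i_1\dots i_n}(\boldsymbol\lambda))=p(i_1,\lambda_1)\cdots p(i_n,\lambda_n)$ for all $n$ and all $i_1,\dots,i_n$. **Dimensions.** A dimension function is a map $\Phi:(0,1)\to[0,\infty)$ such that $t^{1+\Phi(t)}$ decreases to $0$ as $t$ decreases to $0$ and, for some $T,C>0$, $(2t)^{1+\Phi(2t)}\le C\,t^{1+\Phi(t)}$ for all $0<t<T$ with $2t<1$. It is large if, near $0$, $\Phi(t)=h(t)\,\frac{\log|\log t|}{|\log t|}$ with $h(t)\to\infty$ as $t\to0$. The upper $\Phi$-dimension $\overline{\dim}_\Phi\mu$ of a measure $\mu$ is the infimum of all $d\in\mathbb R$ for which there are $C_1,C_2>0$ such that $\frac{\mu(B(x,R))}{\mu(B(x,r))}\le C_2(R/r)^d$ for all $x\in\operatorname{supp}\mu$ and all $0<r<R^{1+\Phi(R)}\le R\le C_1$ with $R<1$. The lower $\Phi$-dimension $\underline{\dim}_\Phi\mu$ is the supremum of all $d\in\mathbb R$ for which the same holds with $\ge$ in place of $\le$ in the inequality for the measures. **Auxiliary functions.** For $\theta\ge0$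 let $m(\theta,\lambda)$ (respectively $m'(\theta,\lambda)$) be the least index $j$ at which $a(j,\lambda)^\theta/p(j,\lambda)$ is maximal (respectively minimal) among $j=1,\dots,K$. Set $$G(\theta)=\frac{\mathbb E\log p(m(\theta,\lambda),\lambda)}{\mathbb E\log a(m(\theta,\lambda),\lambda)},\qquad G'(\theta)=\frac{\mathbb E\log p(m'(\theta,\lambda),\lambda)}{\mathbb E\log a(m'(\theta,\lambda),\lambda)},$$ and, for measurable $\chi:\Lambda\to\{1,\dots,K\}$, $H(\chi)=\mathbb E\log p(\chi(\lambda),\lambda)/\mathbb E\log a(\chi(\lambda),\lambda)$. **Theorem.** (i) $\sup_\chi H(\chi)=\sup_{\theta\ge0}G(\theta)$, and for every large dimension function $\Phi$, almost surely $\overline{\dim}_\Phi\mu_{\boldsymbol\lambda}$ equals this number. (ii) For real $t$: $t=\sup_\chi H(\chi)$ if and only if $t\ge0$ and $G(t)=t$. (iii) $\inf_\chi H(\chi)=\inf_{\theta\ge0}G'(\theta)$, and for every large dimension function $\Phi$, almost surely $\underline{\dim}_\Phi\mu_{\boldsymbol\lambda}$ equals this number. (iv) For real $t$: $t=\inf_\chi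 H(\chi)$ if and only if $t\ge0$ and $G'(t)=t$. In particular each of the equations $G(t)=t$ and $G'(t)=t$ has exactly one solution $t\in[0,\infty)$. -/

import Mathlib

open Set Filter Topology MeasureTheory

noncomputable section

/-! ### Dimension functions and the `Φ`-dimensions of a measure -/

/-- A dimension function `Φ : (0,1) → [0,∞)`: as `t` decreases to `0`, `t ^ (1 + Φ t)` decreases to
`0`, and it is doubling near zero. (Only the values of `Φ` on `(0,1)` matter.) -/
structure IsDimensionFunction (Φ : ℝ → ℝ) : Prop where
  nonneg : ∀ t ∈ Ioo (0 : ℝ) 1, 0 ≤ Φ t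
  monotoneOn : MonotoneOn (fun t : ℝ => t ^ (1 + Φ t)) (Ioo 0 1)
  tendsto_zero : Tendsto (fun t : ℝ => t ^ (1 + Φ t)) (𝓝[>] 0) (𝓝 0)
  doubling : ∃ T > 0, ∃ C > 0, ∀ t : ℝ, 0 < t → t < T → 2 * t < 1 →
    (2 * t) ^ (1 + Φ (2 * t)) ≤ C * t ^ (1 + Φ t)

/-- A dimension function is large if `Φ t = h t * log |log t| / |log t|` (for `t` near `0`) with
`h t → ∞` as `t → 0`. -/
structure IsLargeDimensionFunction (Φ : ℝ → ℝ) : Prop extends IsDimensionFunction Φ where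
  large : ∃ h : ℝ → ℝ, Tendsto h (𝓝[>] 0) atTop ∧
    ∀ᶠ t in 𝓝[>] (0 : ℝ), Φ t = h t * (Real.log |Real.log t| / |Real.log t|)

section PhiDim

variable {X : Type*} [MetricSpace X] [MeasurableSpace X]

/-- The upper `Φ`-dimension of a measure; the infimum is taken in the extended reals, so that it is
`⊤` if no exponent `d` is admissible. -/
def upperPhiDim (Φ : ℝ → ℝ) (μ : Measure X) : EReal :=
  sInf ((fun d : ℝ => (d : EReal)) '' {d : ℝ | ∃ C₁ > 0, ∃ C₂ > 0, ∀ r R : ℝ,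
    0 < r → r < R ^ (1 + Φ R) → R ^ (1 + Φ R) ≤ R → R ≤ C₁ → R < 1 → ∀ x ∈ μ.support,
      μ.real (Metric.ball x R) / μ.real (Metric.ball x r) ≤ C₂ * (R / r) ^ d})

/-- The lower `Φ`-dimension of a measure; the supremum is taken in the extended reals. -/
def lowerPhiDim (Φ : ℝ → ℝ) (μ : Measure X) : EReal :=
  sSup ((fun d : ℝ => (d : EReal)) '' {d : ℝ | ∃ C₁ > 0, ∃ C₂ > 0, ∀ r R : ℝ,
    0 < r → r < R ^ (1 + Φ R) → R ^ (1 + Φ R) ≤ R → R ≤ C₁ → R < 1 → ∀ x ∈ μ.support,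
      C₂ * (R / r) ^ d ≤ μ.real (Metric.ball x R) / μ.real (Metric.ball x r)})

end PhiDim

/-! ### The random model -/

/-- The data of the random model: a family of iterated function systems, indexed by `𝒜`, of `K`
similarities of `[0,1]` with uniform bounds and uniform separation, a family of probability weight
vectors, indexed by `𝒲`, and a probability measure on `𝒜 × 𝒲`, under which every weight has a
finite negative moment. -/
structure RandomMoranModel (K : ℕ) (𝒜 𝒲 : Type*) [MeasurableSpace 𝒜] [MeasurableSpace 𝒲] where
  two_le : 2 ≤ K
  /-- the uniform lower bound of the scaling ratios -/
  A : ℝ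
  /-- the uniform upper bound of the sums of the scaling ratios -/
  B : ℝ
  /-- the uniform separation constant -/
  τ : ℝ
  A_pos : 0 < A
  KA_le : K * A ≤ B
  B_lt_one : B < 1
  τ_pos : 0 < τ
  τ_le : τ ≤ (1 - B) / K
  /-- the `i`-th similarity of the system with index `u` -/
  S : Fin K → 𝒜 → ℝ → ℝ
  /-- the scaling ratio of `S i u` -/
  a : Fin K → 𝒜 → ℝ
  S_mapsTo : ∀ i u, MapsTo (S i u) (Icc 0 1) (Icc 0 1)
  S_similarity : ∀ i u, ∀ x ∈ Icc (0 : ℝ) 1, ∀ y ∈ Icc (0 : ℝ) 1,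
    |S i u x - S i u y| = a i u * |x - y|
  A_le : ∀ i u, A ≤ a i u
  sum_a_le : ∀ u, ∑ i, a i u ≤ B
  separated : ∀ u i j, i ≠ j → ∀ x ∈ Icc (0 : ℝ) 1, ∀ y ∈ Icc (0 : ℝ) 1,
    τ ≤ |S i u x - S j u y|
  measurable_a : ∀ i, Measurable (a i)
  /-- the probability weights -/
  p : Fin K → 𝒲 → ℝ
  p_nonneg : ∀ i v, 0 ≤ p i v
  sum_p : ∀ v, ∑ i, p i v = 1
  measurable_p : ∀ i, Measurable (p i)
  /-- the law of one random choice -/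
  P : Measure (𝒜 × 𝒲)
  isProbabilityMeasure_P : IsProbabilityMeasure P
  /-- `E (p i) ^ (-t) < ∞` for some `t > 0` (where `0 ^ (-t) = ∞`) -/
  moment : ∃ t : ℝ, 0 < t ∧ ∀ i, ∫⁻ l, (ENNReal.ofReal (p i l.2)) ^ (-t) ∂P < ⊤

namespace RandomMoranModel

variable {K : ℕ} {𝒜 𝒲 : Type*} [MeasurableSpace 𝒜] [MeasurableSpace 𝒲]
  (M : RandomMoranModel K 𝒜 𝒲)

/-- The law of the iid sequence of random choices. The choice made at step `n + 1` is the
coordinate with number `n`. -/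
def law : Measure (ℕ → 𝒜 × 𝒲) := Measure.infinitePi fun _ : ℕ => M.P

/-- The composition `S_{w 0}(ω 0) ∘ ⋯ ∘ S_{w (n-1)}(ω (n-1))`. -/
def comp (ω : ℕ → 𝒜 × 𝒲) (w : ℕ → Fin K) : ℕ → ℝ → ℝ
  | 0 => id
  | n + 1 => comp ω w n ∘ M.S (w n) (ω n).1

/-- The Moran interval of level `n` whose index consists of the first `n` letters of `w`. -/
def moranInterval (ω : ℕ → 𝒜 × 𝒲) (w : ℕ → Fin K) (n : ℕ) : Set ℝ :=
  M.comp ω w n '' Icc 0 1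

/-- The random Moran set. -/
def moranSet (ω : ℕ → 𝒜 × 𝒲) : Set ℝ :=
  ⋂ n : ℕ, ⋃ w : ℕ → Fin K, M.moranInterval ω w n

/-- The weight vector `p(·, v)` as a measure on the index set. -/
def weight (v : 𝒲) : Measure (Fin K) :=
  ∑ i, ENNReal.ofReal (M.p i v) • Measure.dirac i

/-- The point of the random Moran set with address `w`. -/
def point (ω : ℕ → 𝒜 × 𝒲) (w : ℕ → Fin K) : ℝ :=
  limUnder atTop fun n => M.comp ω w n 0

/-- The random measure: the law of the point whose address has independent letters, the letter with
number `n` being distributed according to the weight vector chosen at that step. By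
`isProbabilityMeasure_moranMeasure`, `moranMeasure_moranInterval_zero` and
`moranMeasure_moranInterval_succ` below it is a probability measure that satisfies
`μ [0,1] = 1` and `μ (I_{ν,j}) = μ (I_ν) * p(j, ω_{n+1})` for words `ν` of length `n`; by
`moranMeasure_compl_moranSet` it lives on the random Moran set. -/
def moranMeasure (ω : ℕ → 𝒜 × 𝒲) : Measure ℝ :=
  (Measure.infinitePi fun n : ℕ => M.weight (ω n).2).map (M.point ω)

/-! ### The functions `G`, `G'` and `H` -/

lemma exists_isMax (hK : 2 ≤ K) (f : Fin K → ℝ) :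
    (Finset.univ.filter fun i : Fin K => ∀ j, f j ≤ f i).Nonempty := by
  have : Nonempty (Fin K) := ⟨⟨0, by omega⟩⟩
  obtain ⟨i, hi⟩ := Finite.exists_max f
  exact ⟨i, by simpa using hi⟩

/-- The minimal index `m(θ, l)` that maximizes `a(j, l) ^ θ / p(j, l)`. (Almost surely no weight
vanishes.) -/
def m (θ : ℝ) (l : 𝒜 × 𝒲) : Fin K :=
  (Finset.univ.filter fun i : Fin K =>
    ∀ j, M.a j l.1 ^ θ / M.p j l.2 ≤ M.a i l.1 ^ θ / M.p i l.2).min'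
      (exists_isMax M.two_le fun j => M.a j l.1 ^ θ / M.p j l.2)

lemma exists_isMin (hK : 2 ≤ K) (f : Fin K → ℝ) :
    (Finset.univ.filter fun i : Fin K => ∀ j, f i ≤ f j).Nonempty := by
  have : Nonempty (Fin K) := ⟨⟨0, by omega⟩⟩
  obtain ⟨i, hi⟩ := Finite.exists_min f
  exact ⟨i, by simpa using hi⟩

/-- The minimal index `m'(θ, l)` that minimizes `a(j, l) ^ θ / p(j, l)`. -/
def m' (θ : ℝ) (l : 𝒜 × 𝒲) : Fin K :=
  (Finset.univ.filter fun i : Fin K =>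
    ∀ j, M.a i l.1 ^ θ / M.p i l.2 ≤ M.a j l.1 ^ θ / M.p j l.2).min'
      (exists_isMin M.two_le fun j => M.a j l.1 ^ θ / M.p j l.2)

/-- `G(θ) = E log p(m(θ, ·)) / E log a(m(θ, ·))`, considered for `θ ≥ 0`. -/
def G (θ : ℝ) : ℝ :=
  (∫ l, Real.log (M.p (M.m θ l) l.2) ∂M.P) / ∫ l, Real.log (M.a (M.m θ l) l.1) ∂M.P

/-- `G'(θ) = E log p(m'(θ, ·)) / E log a(m'(θ, ·))`, considered for `θ ≥ 0`. -/
def G' (θ : ℝ) : ℝ :=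
  (∫ l, Real.log (M.p (M.m' θ l) l.2) ∂M.P) / ∫ l, Real.log (M.a (M.m' θ l) l.1) ∂M.P

/-- `H(χ) = E log p(χ) / E log a(χ)` for an index-selection function `χ`. -/
def H (χ : 𝒜 × 𝒲 → Fin K) : ℝ :=
  (∫ l, Real.log (M.p (χ l) l.2) ∂M.P) / ∫ l, Real.log (M.a (χ l) l.1) ∂M.P

/-- The supremum of `H(χ)` over all measurable index-selection functions `χ`. -/
def supH : EReal := ⨆ χ : {χ : 𝒜 × 𝒲 → Fin K // Measurable χ}, (M.H χ.1 : EReal)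

/-- The infimum of `H(χ)` over all measurable index-selection functions `χ`. -/
def infH : EReal := ⨅ χ : {χ : 𝒜 × 𝒲 → Fin K // Measurable χ}, (M.H χ.1 : EReal)

/-- The supremum of `G(θ)` over `θ ≥ 0`. -/
def supG : EReal := ⨆ θ : {θ : ℝ // 0 ≤ θ}, (M.G θ.1 : EReal)

/-- The infimum of `G'(θ)` over `θ ≥ 0`. -/
def infG' : EReal := ⨅ θ : {θ : ℝ // 0 ≤ θ}, (M.G' θ.1 : EReal)

/-! ### The random measure satisfies its defining rules -/

instance isProbabilityMeasure_weight (v : 𝒲) : IsProbabilityMeasure (M.weight v) := by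
  constructor
  simp only [weight, Measure.coe_finsetSum, Finset.sum_apply, Measure.smul_apply,
    measure_univ, smul_eq_mul, mul_one]
  rw [← ENNReal.ofReal_sum_of_nonneg (fun i _ => M.p_nonneg i v), M.sum_p, ENNReal.ofReal_one]

lemma weight_singleton (v : 𝒲) (i : Fin K) : M.weight v {i} = ENNReal.ofReal (M.p i v) := by
  simp only [weight, Measure.coe_finsetSum, Finset.sum_apply, Measure.smul_apply, smul_eq_mul]
  rw [Finset.sum_eq_single i]
  · simp
  · intro j _ hj
    simp [hj]
  · simp

lemma a_pos (i : Fin K) (u : 𝒜) : 0 < M.a i u := M.A_pos.trans_le (M.A_le i u)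

lemma a_le (i : Fin K) (u : 𝒜) : M.a i u ≤ M.B :=
  (Finset.single_le_sum (f := fun j => M.a j u) (fun j _ => (M.a_pos j u).le)
    (Finset.mem_univ i)).trans (M.sum_a_le u)

lemma B_pos : 0 < M.B := by
  refine lt_of_lt_of_le (mul_pos ?_ M.A_pos) M.KA_le
  have := M.two_le
  exact_mod_cast (by omega : 0 < K)

lemma comp_mapsTo (ω : ℕ → 𝒜 × 𝒲) (w : ℕ → Fin K) (n : ℕ) :
    MapsTo (M.comp ω w n) (Icc 0 1) (Icc 0 1) := by
  induction n with
  | zero => exact mapsTo_id _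
  | succ n ih => exact ih.comp (M.S_mapsTo _ _)

lemma abs_comp_sub (ω : ℕ → 𝒜 × 𝒲) (w : ℕ → Fin K) (n : ℕ) :
    ∀ x ∈ Icc (0 : ℝ) 1, ∀ y ∈ Icc (0 : ℝ) 1, |M.comp ω w n x - M.comp ω w n y| =
      (∏ k ∈ Finset.range n, M.a (w k) (ω k).1) * |x - y| := by
  induction n with
  | zero => intro x _ y _; simp [comp]
  | succ n ih =>
    intro x hx y hy
    simp only [comp, Function.comp]
    rw [ih _ (M.S_mapsTo _ _ hx) _ (M.S_mapsTo _ _ hy), M.S_similarity _ _ x hx y hy,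
      Finset.prod_range_succ, mul_assoc]

lemma prod_pos (ω : ℕ → 𝒜 × 𝒲) (w : ℕ → Fin K) (n : ℕ) :
    0 < ∏ k ∈ Finset.range n, M.a (w k) (ω k).1 := Finset.prod_pos fun _ _ => M.a_pos _ _

lemma prod_le (ω : ℕ → 𝒜 × 𝒲) (w : ℕ → Fin K) (n : ℕ) :
    ∏ k ∈ Finset.range n, M.a (w k) (ω k).1 ≤ M.B ^ n := by
  calc _ ≤ ∏ _k ∈ Finset.range n, M.B :=
        Finset.prod_le_prod (fun _ _ => (M.a_pos _ _).le) fun _ _ => M.a_le _ _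
    _ = M.B ^ n := by simp

lemma moranInterval_zero (ω : ℕ → 𝒜 × 𝒲) (w : ℕ → Fin K) :
    M.moranInterval ω w 0 = Icc 0 1 := by simp [moranInterval, comp]

lemma moranInterval_succ_subset (ω : ℕ → 𝒜 × 𝒲) (w : ℕ → Fin K) (n : ℕ) :
    M.moranInterval ω w (n + 1) ⊆ M.moranInterval ω w n := by
  rintro _ ⟨x, hx, rfl⟩
  exact ⟨_, M.S_mapsTo _ _ hx, rfl⟩

lemma isClosed_moranInterval (ω : ℕ → 𝒜 × 𝒲) (w : ℕ → Fin K) (n : ℕ) :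
    IsClosed (M.moranInterval ω w n) := by
  refine (isCompact_Icc.image_of_continuousOn ?_).isClosed
  have : LipschitzOnWith (Real.toNNReal (∏ k ∈ Finset.range n, M.a (w k) (ω k).1))
      (M.comp ω w n) (Icc 0 1) := by
    refine LipschitzOnWith.of_dist_le_mul fun x hx y hy => ?_
    rw [Real.dist_eq, Real.dist_eq, M.abs_comp_sub ω w n x hx y hy,
      Real.coe_toNNReal _ (M.prod_pos ω w n).le]
  exact this.continuousOn

lemma tendsto_point (ω : ℕ → 𝒜 × 𝒲) (w : ℕ → Fin K) :
    Tendsto (fun n => M.comp ω w n 0) atTop (𝓝 (M.point ω w)) := by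
  have h0 : (0 : ℝ) ∈ Icc (0 : ℝ) 1 := by simp
  have hc : CauchySeq fun n => M.comp ω w n 0 := by
    refine cauchySeq_of_le_geometric M.B 1 M.B_lt_one fun n => ?_
    have hx := M.S_mapsTo (w n) (ω n).1 h0
    rw [Real.dist_eq, one_mul]
    simp only [comp, Function.comp]
    rw [M.abs_comp_sub ω w n 0 h0 _ hx]
    refine le_trans ?_ (M.prod_le ω w n)
    refine mul_le_of_le_one_right (M.prod_pos ω w n).le ?_
    rw [zero_sub, abs_neg, abs_of_nonneg hx.1]
    exact hx.2
  exact tendsto_nhds_limUnder (cauchySeq_tendsto_of_complete hc)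

lemma point_mem (ω : ℕ → 𝒜 × 𝒲) (w : ℕ → Fin K) (n : ℕ) :
    M.point ω w ∈ M.moranInterval ω w n := by
  refine (M.isClosed_moranInterval ω w n).mem_of_tendsto (M.tendsto_point ω w) ?_
  filter_upwards [eventually_ge_atTop n] with k hk
  have : M.moranInterval ω w k ⊆ M.moranInterval ω w n :=
    antitone_nat_of_succ_le (M.moranInterval_succ_subset ω w) hk
  exact this ⟨0, by simp, rfl⟩

lemma comp_congr (ω : ℕ → 𝒜 × 𝒲) {w w' : ℕ → Fin K} (n : ℕ) (h : ∀ k < n, w k = w' k) :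
    M.comp ω w n = M.comp ω w' n := by
  induction n with
  | zero => rfl
  | succ n ih =>
    simp only [comp]
    rw [ih fun k hk => h k (by omega), h n (by omega)]

/-- Moran intervals of the same level with different addresses are disjoint. -/
lemma eq_of_mem (ω : ℕ → 𝒜 × 𝒲) {w w' : ℕ → Fin K} (n : ℕ) {x : ℝ}
    (h : x ∈ M.moranInterval ω w n) (h' : x ∈ M.moranInterval ω w' n) :
    ∀ k < n, w k = w' k := by
  induction n with
  | zero => intro k hk; omega
  | succ n ih =>
    have hlt := ih (M.moranInterval_succ_subset ω w n h) (M.moranInterval_succ_subset ω w' n h')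
    intro k hk
    rcases Nat.lt_succ_iff_lt_or_eq.1 hk with hk | rfl
    · exact hlt k hk
    · by_contra hne
      obtain ⟨y, hy, hyx⟩ := h
      obtain ⟨z, hz, hzx⟩ := h'
      simp only [comp, Function.comp] at hyx hzx
      rw [← M.comp_congr ω k hlt] at hzx
      have h1 := M.abs_comp_sub ω w k _ (M.S_mapsTo (w k) (ω k).1 hy) _
        (M.S_mapsTo (w' k) (ω k).1 hz)
      rw [hyx, hzx, sub_self, abs_zero] at h1
      have h2 := M.separated (ω k).1 _ _ hne y hy z hz
      have h3 := mul_pos (M.prod_pos ω w k) (M.τ_pos.trans_le h2)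
      linarith

lemma point_mem_iff (ω : ℕ → 𝒜 × 𝒲) (w v : ℕ → Fin K) (n : ℕ) :
    M.point ω v ∈ M.moranInterval ω w n ↔ ∀ k < n, v k = w k := by
  refine ⟨fun h => M.eq_of_mem ω n (M.point_mem ω v n) h, fun h => ?_⟩
  have := M.point_mem ω v n
  rwa [moranInterval, M.comp_congr ω n h] at this

lemma measurable_point (ω : ℕ → 𝒜 × 𝒲) : Measurable (M.point ω) := by
  refine measurable_of_tendsto_metrizable (f := fun n w => M.comp ω w n 0) (fun n => ?_)
    (tendsto_pi_nhds.2 fun w => M.tendsto_point ω w)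
  have i0 : Fin K := ⟨0, by have := M.two_le; omega⟩
  have : (fun w : ℕ → Fin K => M.comp ω w n 0) =
      (fun v : Fin n → Fin K => M.comp ω (fun k => if h : k < n then v ⟨k, h⟩ else i0) n 0) ∘
        fun w k => w k := by
    funext w
    exact congrFun (M.comp_congr ω n fun k hk => by simp [hk]) 0
  rw [this]
  exact (measurable_of_finite _).comp (by fun_prop)

instance isProbabilityMeasure_moranMeasure (ω : ℕ → 𝒜 × 𝒲) :
    IsProbabilityMeasure (M.moranMeasure ω) :=
  Measure.isProbabilityMeasure_map (M.measurable_point ω).aemeasurable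

lemma moranMeasure_moranInterval (ω : ℕ → 𝒜 × 𝒲) (w : ℕ → Fin K) (n : ℕ) :
    M.moranMeasure ω (M.moranInterval ω w n) =
      ∏ k ∈ Finset.range n, ENNReal.ofReal (M.p (w k) (ω k).2) := by
  rw [moranMeasure, Measure.map_apply (M.measurable_point ω)
    (M.isClosed_moranInterval ω w n).measurableSet]
  have : M.point ω ⁻¹' M.moranInterval ω w n =
      Set.pi (Finset.range n : Set ℕ) fun k => {w k} := by
    ext v
    simp [M.point_mem_iff, Set.mem_pi]
  rw [this, Measure.infinitePi_pi _ fun _ _ => MeasurableSet.singleton _]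
  exact Finset.prod_congr rfl fun k _ => M.weight_singleton _ _

theorem moranMeasure_moranInterval_zero (ω : ℕ → 𝒜 × 𝒲) :
    M.moranMeasure ω (Icc 0 1) = 1 := by
  have i0 : Fin K := ⟨0, by have := M.two_le; omega⟩
  rw [← M.moranInterval_zero ω fun _ => i0, moranMeasure_moranInterval]
  simp

theorem moranMeasure_moranInterval_succ (ω : ℕ → 𝒜 × 𝒲) (w : ℕ → Fin K) (n : ℕ) :
    M.moranMeasure ω (M.moranInterval ω w (n + 1)) =
      M.moranMeasure ω (M.moranInterval ω w n) * ENNReal.ofReal (M.p (w n) (ω n).2) := by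
  rw [moranMeasure_moranInterval, moranMeasure_moranInterval, Finset.prod_range_succ]

lemma isClosed_moranSet (ω : ℕ → 𝒜 × 𝒲) : IsClosed (M.moranSet ω) := by
  refine isClosed_iInter fun n => ?_
  have i0 : Fin K := ⟨0, by have := M.two_le; omega⟩
  have : (⋃ w : ℕ → Fin K, M.moranInterval ω w n) = ⋃ v : Fin n → Fin K,
      M.moranInterval ω (fun k => if h : k < n then v ⟨k, h⟩ else i0) n := by
    refine Subset.antisymm (iUnion_subset fun w => ?_)
      (iUnion_subset fun v => subset_iUnion (fun w => M.moranInterval ω w n) _)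
    intro x hx
    refine mem_iUnion.2 ⟨fun k => w k, ?_⟩
    rw [moranInterval] at hx ⊢
    rwa [M.comp_congr ω n (w' := w) fun k hk => by simp [hk]]
  rw [this]
  exact isClosed_iUnion_of_finite fun v => M.isClosed_moranInterval ω _ n

theorem moranMeasure_compl_moranSet (ω : ℕ → 𝒜 × 𝒲) :
    M.moranMeasure ω (M.moranSet ω)ᶜ = 0 := by
  rw [moranMeasure, Measure.map_apply (M.measurable_point ω)
    (M.isClosed_moranSet ω).measurableSet.compl]
  have : M.point ω ⁻¹' (M.moranSet ω)ᶜ = ∅ := by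
    ext v
    simp only [mem_preimage, mem_compl_iff, mem_empty_iff_false, iff_false, not_not]
    exact mem_iInter.2 fun n => mem_iUnion.2 ⟨v, M.point_mem ω v n⟩
  rw [this, measure_empty]

end RandomMoranModel

end

/-!
Write `X j = -log p(j, ·) ≥ 0` and `Y j = -log a(j, ·)`, the latter between two positive constants.
For a selection `χ` the mean excess at `θ` is `E (X χ - θ Y χ) = (H χ - θ) * E (Y χ)`, so its sign
compares `H χ` with `θ` (`integral_excess`). Almost surely no weight vanishes, and then `m θ`
maximizes and `m' θ` minimizes `X j - θ Y j` pointwise. Hence `E max_j (X j - θ Y j)` vanishes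
exactly when `G θ = θ`; as a function of `θ` it is Lipschitz, strictly decreasing at a positive
rate, and nonnegative at `0`, so it has exactly one zero `t ≥ 0` (`existsUnique_G_eq`). At this `t`
all mean excesses are at most zero and that of `m t` is zero, so `t = H (m t)` is the maximum of `H`
and therefore also that of `G`. Minima are treated in the same way.

For the dimensions, let `x` be the point with address `w`. By the uniform separation, a ball around
`x` has, up to a bounded change of the radius, the mass of a Moran interval around `x`
(`measure_ball_le_mass`, `mass_le_measure_ball`). So if the radii `R > r` belong to the levels
`N ≤ n`, then `μ(B(x,R)) / μ(B(x,r))` and `R / r` are comparable with the exponentials of the sums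
of `X (w k)` and `Y (w k)` over `N ≤ k < n`, and the exponent `d` is tested by the block sums of
`X (w k) - d Y (w k)`.

* For `d > t` these are bounded by the block sums of an iid sequence with negative mean and some
  finite exponential moment. Since `Φ` is large, only blocks with `n - N ≥ D log (N + 1)` occur,
  where `D` may be chosen arbitrarily large (`exists_level_gap`). Chernoff's bound and the
  Borel-Cantelli lemma bound all these sums at once (`ae_exists_bound_sum_Ico`), so `d` is
  admissible for the upper dimension.
* For `d < t` take the point whose address follows the selection `m t`. By the law of large numbers
  the sums over `N ≤ k < n` tend to `∞` with `n`, for each fixed `N`. The definition of the dimension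
  allows arbitrarily small `r` for a fixed `R`, so `d` is not admissible (`not_exists_upper_bound`).

The lower dimension is symmetric, with `m'` in place of `m`.
-/

/-! ### Sums of independent identically distributed variables -/

section IID

variable {Λ : Type*} [MeasurableSpace Λ] {P : Measure Λ} [IsProbabilityMeasure P]

/-- The strong law of large numbers for a function of the coordinates of an iid sequence. -/
lemma ae_tendsto_sum_range_div {Z : Λ → ℝ} (hZ : Measurable Z) (hint : Integrable Z P) :
    ∀ᵐ ω ∂(Measure.infinitePi fun _ : ℕ => P),
      Tendsto (fun n : ℕ => (∑ k ∈ Finset.range n, Z (ω k)) / n) atTop (𝓝 (∫ l, Z l ∂P)) := by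
  have hmp : ∀ k : ℕ, MeasurePreserving (Function.eval k)
      (Measure.infinitePi fun _ : ℕ => P) P :=
    fun k => measurePreserving_eval_infinitePi (fun _ : ℕ => P) k
  have hmap : ∀ k : ℕ, Measure.map (fun ω : ℕ → Λ => Z (ω k))
      (Measure.infinitePi fun _ : ℕ => P) = P.map Z := fun k => by
    conv_rhs => rw [← (hmp k).map_eq]
    rw [Measure.map_map hZ (hmp k).measurable]
    rfl
  have hindep : ProbabilityTheory.iIndepFun (fun (k : ℕ) (ω : ℕ → Λ) => Z (ω k))
      (Measure.infinitePi fun _ : ℕ => P) :=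
    ProbabilityTheory.iIndepFun_infinitePi (X := fun _ : ℕ => Z) fun _ => hZ
  have h := ProbabilityTheory.strong_law_ae_real (μ := Measure.infinitePi fun _ : ℕ => P)
    (fun (k : ℕ) ω => Z (ω k)) ((hmp 0).integrable_comp_of_integrable hint)
    (fun i j hij => hindep.indepFun hij)
    (fun i => ⟨(hZ.comp (measurable_pi_apply i)).aemeasurable,
      (hZ.comp (measurable_pi_apply 0)).aemeasurable, by rw [hmap, hmap]⟩)
  have h0 : ∫ ω : ℕ → Λ, Z (ω 0) ∂(Measure.infinitePi fun _ : ℕ => P) = ∫ l, Z l ∂P := by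
    conv_rhs => rw [← (hmp 0).map_eq]
    exact (integral_map (hmp 0).aemeasurable (by fun_prop)).symm
  rwa [h0] at h

/-- A variable with negative mean and some finite exponential moment has a Laplace transform
smaller than `1` somewhere on the positive axis. -/
lemma exists_mgf_lt_one {Z : Λ → ℝ} (hZ : Measurable Z) {s : ℝ} (hs : 0 < s)
    (hexp : Integrable (fun l => Real.exp (s * |Z l|)) P) (hneg : ∫ l, Z l ∂P < 0) :
    ∃ u, 0 < u ∧ Integrable (fun l => Real.exp (u * Z l)) P ∧
      ProbabilityTheory.mgf Z P u < 1 := by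
  have hint : ∀ u, |u| ≤ s → Integrable (fun l => Real.exp (u * Z l)) P := fun u hu => by
    refine hexp.mono' (by fun_prop) (ae_of_all _ fun l => ?_)
    rw [Real.norm_eq_abs, Real.abs_exp]
    refine Real.exp_le_exp.2 ((le_abs_self _).trans ?_)
    rw [abs_mul]
    gcongr
  have h0 : (0 : ℝ) ∈ interior (ProbabilityTheory.integrableExpSet Z P) := by
    rw [mem_interior_iff_mem_nhds]
    filter_upwards [Metric.closedBall_mem_nhds (0 : ℝ) hs] with u hu
    exact hint u (by simpa using hu)
  have hd : HasDerivAt (ProbabilityTheory.mgf Z P) (∫ l, Z l ∂P) 0 := by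
    simpa using ProbabilityTheory.hasDerivAt_mgf h0
  have hlt : ∀ᶠ u in 𝓝[>] (0 : ℝ), u < s := nhdsWithin_le_nhds (Iio_mem_nhds hs)
  have hpos : ∀ᶠ u in 𝓝[>] (0 : ℝ), 0 < u := self_mem_nhdsWithin
  obtain ⟨u, hslope, hus, hu⟩ := (((hd.hasDerivWithinAt (s := Ioi 0)).limsup_slope_le'
    (by simp) hneg).and (hlt.and hpos)).exists
  refine ⟨u, hu, hint u (by rw [abs_of_pos hu]; exact hus.le), ?_⟩
  rw [slope_def_field, sub_zero, div_lt_iff₀ hu, zero_mul, ProbabilityTheory.mgf_zero] at hslope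
  linarith

/-- For an iid sequence of variables with negative mean and some finite exponential moment, the
block sums are bounded above, uniformly over all blocks whose length is at least a large multiple
of the logarithm of their starting point. -/
lemma ae_exists_bound_sum_Ico {Z : Λ → ℝ} (hZ : Measurable Z) {s : ℝ} (hs : 0 < s)
    (hexp : Integrable (fun l => Real.exp (s * |Z l|)) P) (hneg : ∫ l, Z l ∂P < 0) :
    ∃ D : ℝ, 0 ≤ D ∧ ∀ᵐ ω ∂(Measure.infinitePi fun _ : ℕ => P), ∃ C : ℝ, ∀ N n : ℕ,
      N + D * Real.log (N + 1) ≤ n → ∑ k ∈ Finset.Ico N n, Z (ω k) ≤ C := by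
  obtain ⟨u, hu, hint, hlt⟩ := exists_mgf_lt_one hZ hs hexp hneg
  set ρ := ProbabilityTheory.mgf Z P u with hρ
  have hρ0 : 0 < ρ := ProbabilityTheory.mgf_pos hint
  have hlog : Real.log ρ < 0 := Real.log_neg hρ0 hlt
  set Q : Measure (ℕ → Λ) := Measure.infinitePi fun _ : ℕ => P with hQ
  have hmp : ∀ k : ℕ, MeasurePreserving (Function.eval k) Q P :=
    fun k => measurePreserving_eval_infinitePi (fun _ : ℕ => P) k
  have hindep : ProbabilityTheory.iIndepFun (fun (k : ℕ) (ω : ℕ → Λ) => Z (ω k)) Q :=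
    ProbabilityTheory.iIndepFun_infinitePi (X := fun _ : ℕ => Z) fun _ => hZ
  have hmeas : ∀ k : ℕ, Measurable fun ω : ℕ → Λ => Z (ω k) := fun k => by fun_prop
  have hmgf : ∀ k : ℕ, ProbabilityTheory.mgf (fun ω : ℕ → Λ => Z (ω k)) Q u = ρ := fun k => by
    rw [hρ, ← (hmp k).map_eq, ProbabilityTheory.mgf_map (hmp k).aemeasurable (by fun_prop)]
    rfl
  -- Chernoff's bound for one block
  have hcher : ∀ N n : ℕ, Q.real {ω | 0 ≤ ∑ k ∈ Finset.Ico N n, Z (ω k)} ≤ ρ ^ (n - N) := by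
    intro N n
    have h1 := ProbabilityTheory.measure_ge_le_exp_mul_mgf (μ := Q)
      (X := ∑ k ∈ Finset.Ico N n, fun ω : ℕ → Λ => Z (ω k)) 0 hu.le
      (hindep.integrable_exp_mul_sum hmeas fun k _ =>
        (hmp k).integrable_comp_of_integrable hint)
    rw [hindep.mgf_sum hmeas, Finset.prod_congr rfl fun k _ => hmgf k] at h1
    simpa using h1
  refine ⟨-4 / Real.log ρ, div_nonneg_of_nonpos (by norm_num) hlog.le, ?_⟩
  -- the blocks are parametrized by their starting point and their length
  set E : ℕ × ℕ → Set (ℕ → Λ) := fun q => {ω | -4 / Real.log ρ * Real.log (q.1 + 1) ≤ q.2 ∧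
    0 ≤ ∑ k ∈ Finset.Ico q.1 (q.1 + q.2), Z (ω k)} with hE
  have hb : ∀ q, Q (E q) ≤
      ENNReal.ofReal (1 / ((q.1 : ℝ) + 1) ^ 2 * (Real.sqrt ρ) ^ q.2) := by
    rintro ⟨N, j⟩
    by_cases hj : -4 / Real.log ρ * Real.log (N + 1) ≤ j
    · rw [← ofReal_measureReal]
      refine ENNReal.ofReal_le_ofReal ?_
      refine (measureReal_mono fun ω hω => hω.2).trans ((hcher N (N + j)).trans ?_)
      have hN : (0 : ℝ) < (N : ℝ) + 1 := by positivity
      -- half of the exponent pays for the sum over the starting points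
      have h2 : (Real.sqrt ρ) ^ j ≤ 1 / ((N : ℝ) + 1) ^ 2 := by
        rw [one_div, ← Real.log_le_log_iff (by positivity) (by positivity), Real.log_pow,
          Real.log_inv, Real.log_pow, Real.log_sqrt hρ0.le]
        have h3 := mul_le_mul_of_nonpos_right hj hlog.le
        have h4 : -4 / Real.log ρ * Real.log (N + 1) * Real.log ρ = -4 * Real.log (N + 1) := by
          field_simp [hlog.ne]
        push_cast
        linarith
      calc ρ ^ (N + j - N) = (Real.sqrt ρ) ^ j * (Real.sqrt ρ) ^ j := by
            rw [← mul_pow, Real.mul_self_sqrt hρ0.le, Nat.add_sub_cancel_left]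
        _ ≤ _ := by gcongr
    · have : E (N, j) = ∅ := by
        ext ω
        simp only [hE, mem_ofPred_eq, mem_empty_iff_false, iff_false, not_and]
        exact fun h => absurd h hj
      rw [this]
      simp
  have hsum : Summable fun q : ℕ × ℕ =>
      1 / ((q.1 : ℝ) + 1) ^ 2 * (Real.sqrt ρ) ^ q.2 := by
    have h1 : Summable fun N : ℕ => 1 / ((N : ℝ) + 1) ^ 2 := by
      simpa using (summable_nat_add_iff 1).2 (Real.summable_one_div_nat_pow.2 one_lt_two)
    have h2 : Summable fun j : ℕ => (Real.sqrt ρ) ^ j :=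
      summable_geometric_of_lt_one (Real.sqrt_nonneg _) (by
        rw [Real.sqrt_lt' one_pos]; simpa using hlt)
    exact h1.mul_of_nonneg h2 (fun _ => by positivity) (fun _ => by positivity)
  have hfin : ∑' q, Q (E q) ≠ ⊤ :=
    ne_top_of_le_ne_top hsum.tsum_ofReal_ne_top (ENNReal.tsum_le_tsum hb)
  filter_upwards [ae_finite_setOfPred_mem hfin] with ω hω
  obtain ⟨C, hC⟩ := (hω.image fun q => ∑ k ∈ Finset.Ico q.1 (q.1 + q.2), Z (ω k)).bddAbove
  refine ⟨max C 0, fun N n hn => ?_⟩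
  have hNn : N ≤ n := by
    have h1 : 0 ≤ -4 / Real.log ρ * Real.log ((N : ℝ) + 1) :=
      mul_nonneg (div_nonneg_of_nonpos (by norm_num) hlog.le)
        (Real.log_nonneg (by linarith [(Nat.cast_nonneg N : (0 : ℝ) ≤ N)]))
    exact_mod_cast (by linarith : (N : ℝ) ≤ n)
  obtain ⟨j, rfl⟩ := Nat.exists_eq_add_of_le hNn
  rcases le_total (∑ k ∈ Finset.Ico N (N + j), Z (ω k)) 0 with h | h
  · exact h.trans (le_max_right _ _)
  · refine le_trans (hC ⟨(N, j), ⟨?_, h⟩, rfl⟩) (le_max_left _ _)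
    push_cast at hn
    simpa using hn

end IID

noncomputable section

/-! ### Log-weights and index-selection functions -/

namespace RandomMoranModel

variable {K : ℕ} {𝒜 𝒲 : Type*} [MeasurableSpace 𝒜] [MeasurableSpace 𝒲]
  (M : RandomMoranModel K 𝒜 𝒲)

instance : IsProbabilityMeasure M.P := M.isProbabilityMeasure_P

/-- `-log p(j, l)`; its value is `0` if the weight vanishes. -/
def negLogP (j : Fin K) (l : 𝒜 × 𝒲) : ℝ := -Real.log (M.p j l.2)

/-- `-log a(j, l)`. -/
def negLogA (j : Fin K) (l : 𝒜 × 𝒲) : ℝ := -Real.log (M.a j l.1)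

lemma p_le_one (j : Fin K) (v : 𝒲) : M.p j v ≤ 1 :=
  (Finset.single_le_sum (f := fun j => M.p j v) (fun j _ => M.p_nonneg j v)
    (Finset.mem_univ j)).trans (M.sum_p v).le

lemma negLogP_nonneg (j : Fin K) (l : 𝒜 × 𝒲) : 0 ≤ M.negLogP j l :=
  neg_nonneg.2 (Real.log_nonpos (M.p_nonneg j l.2) (M.p_le_one j l.2))

lemma neg_log_B_pos : 0 < -Real.log M.B := neg_pos.2 (Real.log_neg M.B_pos M.B_lt_one)

lemma neg_log_B_le (j : Fin K) (l : 𝒜 × 𝒲) : -Real.log M.B ≤ M.negLogA j l :=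
  neg_le_neg (Real.log_le_log (M.a_pos j l.1) (M.a_le j l.1))

lemma negLogA_pos (j : Fin K) (l : 𝒜 × 𝒲) : 0 < M.negLogA j l :=
  M.neg_log_B_pos.trans_le (M.neg_log_B_le j l)

lemma negLogA_le (j : Fin K) (l : 𝒜 × 𝒲) : M.negLogA j l ≤ -Real.log M.A :=
  neg_le_neg (Real.log_le_log M.A_pos (M.A_le j l.1))

lemma measurable_negLogP (j : Fin K) : Measurable (M.negLogP j) :=
  (Real.measurable_log.comp ((M.measurable_p j).comp measurable_snd)).neg

lemma measurable_negLogA (j : Fin K) : Measurable (M.negLogA j) :=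
  (Real.measurable_log.comp ((M.measurable_a j).comp measurable_fst)).neg

/-- Almost surely no weight vanishes: a vanishing weight has an infinite negative power. -/
lemma ae_p_pos : ∀ᵐ l ∂M.P, ∀ j, 0 < M.p j l.2 := by
  obtain ⟨t, ht, hm⟩ := M.moment
  rw [ae_all_iff]
  intro j
  have hmeas : Measurable fun l : 𝒜 × 𝒲 => (ENNReal.ofReal (M.p j l.2)) ^ (-t) :=
    (((M.measurable_p j).comp measurable_snd).ennreal_ofReal).pow_const _
  filter_upwards [ae_lt_top hmeas (hm j).ne] with l hl
  by_contra h
  rw [ENNReal.ofReal_of_nonpos (not_lt.1 h), ENNReal.zero_rpow_of_neg (by linarith)] at hl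
  exact lt_irrefl _ hl

/-- The negative moment of a weight is an exponential moment of its negative logarithm. -/
lemma exists_integrable_exp_negLogP :
    ∃ s, 0 < s ∧ ∀ j, Integrable (fun l => Real.exp (s * M.negLogP j l)) M.P := by
  obtain ⟨s, hs, hm⟩ := M.moment
  refine ⟨s, hs, fun j => ⟨(by
    have := M.measurable_negLogP j
    fun_prop), ?_⟩⟩
  rw [hasFiniteIntegral_iff_ofReal (ae_of_all _ fun l => (Real.exp_pos _).le)]
  refine lt_of_le_of_lt (lintegral_mono_ae ?_) (hm j)
  filter_upwards [M.ae_p_pos] with l hl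
  rw [ENNReal.ofReal_rpow_of_pos (hl j), Real.rpow_def_of_pos (hl j), negLogP]
  exact ENNReal.ofReal_le_ofReal (Real.exp_le_exp.2 (by linarith))

lemma integrable_negLogP (j : Fin K) : Integrable (M.negLogP j) M.P := by
  obtain ⟨s, hs, hexp⟩ := M.exists_integrable_exp_negLogP
  refine ((hexp j).div_const s).mono' (M.measurable_negLogP j).aestronglyMeasurable
    (ae_of_all _ fun l => ?_)
  rw [Real.norm_eq_abs, abs_of_nonneg (M.negLogP_nonneg j l), le_div_iff₀ hs]
  linarith [Real.add_one_le_exp (s * M.negLogP j l)]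

/-! ### Selections -/

variable {M}

section Selection

variable {χ : 𝒜 × 𝒲 → Fin K}

lemma measurable_selection {f : Fin K → 𝒜 × 𝒲 → ℝ} (hf : ∀ j, Measurable (f j))
    (hχ : Measurable χ) : Measurable fun l => f (χ l) l :=
  (measurable_from_prod_countable_right (f := fun q : Fin K × (𝒜 × 𝒲) => f q.1 q.2) hf).comp
    (hχ.prodMk measurable_id)

lemma integrable_negLogP_selection (hχ : Measurable χ) :
    Integrable (fun l => M.negLogP (χ l) l) M.P := by
  refine (integrable_finsetSum Finset.univ fun j _ => M.integrable_negLogP j).mono'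
    (measurable_selection M.measurable_negLogP hχ).aestronglyMeasurable (ae_of_all _ fun l => ?_)
  rw [Real.norm_eq_abs, abs_of_nonneg (M.negLogP_nonneg _ l)]
  exact Finset.single_le_sum (f := fun j => M.negLogP j l) (fun j _ => M.negLogP_nonneg j l)
    (Finset.mem_univ _)

lemma integrable_negLogA_selection (hχ : Measurable χ) :
    Integrable (fun l => M.negLogA (χ l) l) M.P := by
  refine (integrable_const (-Real.log M.A)).mono'
    (measurable_selection M.measurable_negLogA hχ).aestronglyMeasurable (ae_of_all _ fun l => ?_)
  rw [Real.norm_eq_abs, abs_of_pos (M.negLogA_pos _ l)]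
  exact M.negLogA_le _ l

lemma integral_negLogA_selection_pos (hχ : Measurable χ) :
    0 < ∫ l, M.negLogA (χ l) l ∂M.P := by
  refine M.neg_log_B_pos.trans_le ?_
  have := integral_mono (μ := M.P) (integrable_const (-Real.log M.B))
    (integrable_negLogA_selection hχ) fun l => M.neg_log_B_le (χ l) l
  simpa using this

/-- The excess `-log p(χ(l), l) + θ log a(χ(l), l)` of a selection. -/
def excess (M : RandomMoranModel K 𝒜 𝒲) (θ : ℝ) (χ : 𝒜 × 𝒲 → Fin K) (l : 𝒜 × 𝒲) : ℝ :=
  M.negLogP (χ l) l - θ * M.negLogA (χ l) l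

lemma measurable_excess (θ : ℝ) (hχ : Measurable χ) : Measurable (M.excess θ χ) :=
  (measurable_selection M.measurable_negLogP hχ).sub
    ((measurable_selection M.measurable_negLogA hχ).const_mul θ)

lemma integrable_excess (θ : ℝ) (hχ : Measurable χ) : Integrable (M.excess θ χ) M.P :=
  (integrable_negLogP_selection hχ).sub ((integrable_negLogA_selection hχ).const_mul θ)

/-- The sign of the mean excess tells on which side of `θ` the quotient `H χ` lies. -/
lemma integral_excess (θ : ℝ) (hχ : Measurable χ) :
    ∫ l, M.excess θ χ l ∂M.P = (M.H χ - θ) * ∫ l, M.negLogA (χ l) l ∂M.P := by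
  have h1 : M.H χ * ∫ l, M.negLogA (χ l) l ∂M.P = ∫ l, M.negLogP (χ l) l ∂M.P := by
    have h := (integral_negLogA_selection_pos (M := M) hχ).ne'
    simp only [negLogA, negLogP, integral_neg] at h ⊢
    rw [H, mul_neg, div_mul_cancel₀ _ (neg_ne_zero.1 h)]
  simp only [excess]
  rw [integral_sub (integrable_negLogP_selection hχ)
    ((integrable_negLogA_selection hχ).const_mul θ), integral_const_mul, sub_mul, h1]

lemma exists_integrable_exp_abs_excess (θ : ℝ) (hχ : Measurable χ) :
    ∃ s, 0 < s ∧ Integrable (fun l => Real.exp (s * |M.excess θ χ l|)) M.P := by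
  obtain ⟨s, hs, hexp⟩ := M.exists_integrable_exp_negLogP
  have hmeas := measurable_excess (M := M) θ hχ
  refine ⟨s, hs, ((integrable_finsetSum Finset.univ fun j _ => hexp j).const_mul
    (Real.exp (s * (|θ| * -Real.log M.A)))).mono' (by fun_prop) (ae_of_all _ fun l => ?_)⟩
  rw [Real.norm_eq_abs, Real.abs_exp]
  refine le_trans ?_ (mul_le_mul_of_nonneg_left (Finset.single_le_sum
    (f := fun j => Real.exp (s * M.negLogP j l)) (fun j _ => (Real.exp_pos _).le)
    (Finset.mem_univ (χ l))) (Real.exp_pos _).le)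
  rw [← Real.exp_add, ← mul_add]
  refine Real.exp_le_exp.2 (mul_le_mul_of_nonneg_left ?_ hs.le)
  refine (abs_sub _ _).trans ?_
  rw [abs_of_nonneg (M.negLogP_nonneg _ l), abs_mul, abs_of_pos (M.negLogA_pos _ l), add_comm]
  gcongr
  exact M.negLogA_le _ l

end Selection

/-! ### The extremal selections -/

lemma measurable_min' {Λ : Type*} [MeasurableSpace Λ] {s : Λ → Finset (Fin K)}
    (hs : ∀ l, (s l).Nonempty) (hmeas : ∀ i, MeasurableSet {l | i ∈ s l}) :
    Measurable fun l => (s l).min' (hs l) := by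
  refine measurable_to_countable' fun i => ?_
  have : (fun l => (s l).min' (hs l)) ⁻¹' {i} =
      {l | i ∈ s l} ∩ ⋂ j : Fin K, {l | j ∈ s l → i ≤ j} := by
    ext l
    simp only [mem_preimage, mem_singleton_iff, Finset.min'_eq_iff, mem_inter_iff, mem_ofPred_eq,
      mem_iInter]
  rw [this]
  refine (hmeas i).inter (MeasurableSet.iInter fun j => ?_)
  by_cases hij : i ≤ j
  · simp [hij]
  · simp only [hij, imp_false]
    exact (hmeas j).compl

lemma measurable_rpow_div (θ : ℝ) (j : Fin K) :
    Measurable fun l : 𝒜 × 𝒲 => M.a j l.1 ^ θ / M.p j l.2 :=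
  (((M.measurable_a j).comp measurable_fst).pow_const θ).div
    ((M.measurable_p j).comp measurable_snd)

lemma measurable_m (M : RandomMoranModel K 𝒜 𝒲) (θ : ℝ) : Measurable (M.m θ) := by
  refine measurable_min' _ fun i => ?_
  simp only [Finset.mem_filter, Finset.mem_univ, true_and, ofPred_forall]
  exact MeasurableSet.iInter fun j =>
    measurableSet_le (measurable_rpow_div θ j) (measurable_rpow_div θ i)

lemma measurable_m' (M : RandomMoranModel K 𝒜 𝒲) (θ : ℝ) : Measurable (M.m' θ) := by
  refine measurable_min' _ fun i => ?_
  simp only [Finset.mem_filter, Finset.mem_univ, true_and, ofPred_forall]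
  exact MeasurableSet.iInter fun j =>
    measurableSet_le (measurable_rpow_div θ i) (measurable_rpow_div θ j)

lemma rpow_div_eq_exp (θ : ℝ) {l : 𝒜 × 𝒲} {j : Fin K} (hp : 0 < M.p j l.2) :
    M.a j l.1 ^ θ / M.p j l.2 = Real.exp (M.negLogP j l - θ * M.negLogA j l) := by
  rw [negLogP, negLogA, Real.rpow_def_of_pos (M.a_pos j l.1), ← Real.exp_log hp, ← Real.exp_sub,
    Real.log_exp]
  ring_nf

/-- The selection `m θ` maximizes the excess at `θ` pointwise. Positivity of the weights is needed
because a quotient by a vanishing weight is `0` instead of `∞`. -/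
lemma le_excess_m (θ : ℝ) {l : 𝒜 × 𝒲} (hp : ∀ j, 0 < M.p j l.2) (j : Fin K) :
    M.negLogP j l - θ * M.negLogA j l ≤ M.excess θ (M.m θ) l := by
  have h := (Finset.mem_filter.1 (Finset.min'_mem _ (exists_isMax M.two_le
    fun j => M.a j l.1 ^ θ / M.p j l.2))).2 j
  rw [rpow_div_eq_exp θ (hp _), rpow_div_eq_exp θ (hp _)] at h
  exact Real.exp_le_exp.1 h

/-- The selection `m' θ` minimizes the excess at `θ` pointwise. -/
lemma excess_m'_le (θ : ℝ) {l : 𝒜 × 𝒲} (hp : ∀ j, 0 < M.p j l.2) (j : Fin K) :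
    M.excess θ (M.m' θ) l ≤ M.negLogP j l - θ * M.negLogA j l := by
  have h := (Finset.mem_filter.1 (Finset.min'_mem _ (exists_isMin M.two_le
    fun j => M.a j l.1 ^ θ / M.p j l.2))).2 j
  rw [rpow_div_eq_exp θ (hp _), rpow_div_eq_exp θ (hp _)] at h
  exact Real.exp_le_exp.1 h

lemma integral_excess_le_m (θ : ℝ) {χ : 𝒜 × 𝒲 → Fin K} (hχ : Measurable χ) :
    ∫ l, M.excess θ χ l ∂M.P ≤ ∫ l, M.excess θ (M.m θ) l ∂M.P := by
  refine integral_mono_ae (integrable_excess θ hχ) (integrable_excess θ (M.measurable_m θ)) ?_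
  filter_upwards [M.ae_p_pos] with l hl
  exact le_excess_m θ hl _

lemma integral_excess_m'_le (θ : ℝ) {χ : 𝒜 × 𝒲 → Fin K} (hχ : Measurable χ) :
    ∫ l, M.excess θ (M.m' θ) l ∂M.P ≤ ∫ l, M.excess θ χ l ∂M.P := by
  refine integral_mono_ae (integrable_excess θ (M.measurable_m' θ)) (integrable_excess θ hχ) ?_
  filter_upwards [M.ae_p_pos] with l hl
  exact excess_m'_le θ hl _

lemma integral_excess_zero_nonneg {χ : 𝒜 × 𝒲 → Fin K} : 0 ≤ ∫ l, M.excess 0 χ l ∂M.P :=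
  integral_nonneg fun l => by simpa [excess] using M.negLogP_nonneg _ l

/-- As `θ` grows, the mean excess of a fixed selection decreases at a rate between `-log B` and
`-log A`. -/
lemma integral_excess_bounds {χ : 𝒜 × 𝒲 → Fin K} (hχ : Measurable χ) {θ θ' : ℝ} (h : θ ≤ θ') :
    ∫ l, M.excess θ' χ l ∂M.P ≤ ∫ l, M.excess θ χ l ∂M.P - -Real.log M.B * (θ' - θ) ∧
    ∫ l, M.excess θ χ l ∂M.P - -Real.log M.A * (θ' - θ) ≤ ∫ l, M.excess θ' χ l ∂M.P := by
  have hA : ∫ l, M.negLogA (χ l) l ∂M.P ≤ -Real.log M.A := by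
    simpa using integral_mono (μ := M.P) (integrable_negLogA_selection hχ)
      (integrable_const (-Real.log M.A)) fun l => M.negLogA_le (χ l) l
  have hB : -Real.log M.B ≤ ∫ l, M.negLogA (χ l) l ∂M.P := by
    simpa using integral_mono (μ := M.P) (integrable_const (-Real.log M.B))
      (integrable_negLogA_selection hχ) fun l => M.neg_log_B_le (χ l) l
  rw [integral_excess θ hχ, integral_excess θ' hχ]
  constructor <;> nlinarith

/-- A function that decreases at rates between two positive bounds and is nonnegative at `0` has
exactly one zero on `[0,∞)`. -/
lemma existsUnique_zero {f : ℝ → ℝ} {b b' : ℝ} (hb : 0 < b)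
    (hf : ∀ θ θ', θ ≤ θ' → f θ' ≤ f θ - b * (θ' - θ) ∧ f θ - b' * (θ' - θ) ≤ f θ')
    (h0 : 0 ≤ f 0) : ∃! t, 0 ≤ t ∧ f t = 0 := by
  have hcont : Continuous f := by
    refine (LipschitzWith.of_dist_le_mul (K := b'.toNNReal) fun x y => ?_).continuous
    rw [Real.dist_eq, Real.dist_eq]
    have hb' : b' ≤ b'.toNNReal := Real.le_coe_toNNReal b'
    rcases le_total x y with h | h
    · obtain ⟨h1, h2⟩ := hf x y h
      rw [abs_of_nonneg (by nlinarith), abs_of_nonpos (by linarith)]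
      nlinarith
    · obtain ⟨h1, h2⟩ := hf y x h
      rw [abs_of_nonpos (by nlinarith), abs_of_nonneg (by linarith)]
      nlinarith
  have hT : 0 ≤ f 0 / b := div_nonneg h0 hb.le
  have hfT : f (f 0 / b) ≤ 0 := by
    have := (hf 0 _ hT).1
    rwa [sub_zero, mul_div_cancel₀ _ hb.ne', sub_self] at this
  obtain ⟨t, ht, hft⟩ := intermediate_value_Icc' hT hcont.continuousOn ⟨hfT, h0⟩
  refine ⟨t, ⟨ht.1, hft⟩, fun t' ⟨_, ht'⟩ => ?_⟩
  rcases le_total t t' with h | h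
  · have := (hf _ _ h).1
    nlinarith
  · have := (hf _ _ h).1
    nlinarith

lemma G_eq_iff (t : ℝ) : M.G t = t ↔ ∫ l, M.excess t (M.m t) l ∂M.P = 0 := by
  rw [integral_excess t (M.measurable_m t), mul_eq_zero, sub_eq_zero,
    or_iff_left (integral_negLogA_selection_pos (M.measurable_m t)).ne']
  rfl

lemma G'_eq_iff (t : ℝ) : M.G' t = t ↔ ∫ l, M.excess t (M.m' t) l ∂M.P = 0 := by
  rw [integral_excess t (M.measurable_m' t), mul_eq_zero, sub_eq_zero,
    or_iff_left (integral_negLogA_selection_pos (M.measurable_m' t)).ne']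
  rfl

variable (M)

lemma existsUnique_G_eq : ∃! t : ℝ, 0 ≤ t ∧ M.G t = t := by
  simp only [G_eq_iff]
  refine existsUnique_zero (b' := -Real.log M.A) M.neg_log_B_pos (fun θ θ' h => ⟨?_, ?_⟩)
    integral_excess_zero_nonneg
  · have h1 := integral_excess_le_m (M := M) θ (M.measurable_m θ')
    have h2 := (integral_excess_bounds (M := M) (M.measurable_m θ') h).1
    linarith
  · have h1 := integral_excess_le_m (M := M) θ' (M.measurable_m θ)
    have h2 := (integral_excess_bounds (M := M) (M.measurable_m θ) h).2
    linarith

lemma existsUnique_G'_eq : ∃! t : ℝ, 0 ≤ t ∧ M.G' t = t := by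
  simp only [G'_eq_iff]
  refine existsUnique_zero (b' := -Real.log M.A) M.neg_log_B_pos (fun θ θ' h => ⟨?_, ?_⟩)
    integral_excess_zero_nonneg
  · have h1 := integral_excess_m'_le (M := M) θ' (M.measurable_m' θ)
    have h2 := (integral_excess_bounds (M := M) (M.measurable_m' θ) h).1
    linarith
  · have h1 := integral_excess_m'_le (M := M) θ (M.measurable_m' θ')
    have h2 := (integral_excess_bounds (M := M) (M.measurable_m' θ') h).2
    linarith

variable {M}

lemma H_le_of_G_eq {t : ℝ} (ht : M.G t = t) {χ : 𝒜 × 𝒲 → Fin K} (hχ : Measurable χ) :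
    M.H χ ≤ t := by
  have h1 := integral_excess_le_m (M := M) t hχ
  rw [(G_eq_iff t).1 ht, integral_excess t hχ] at h1
  have h2 := integral_negLogA_selection_pos (M := M) hχ
  by_contra! h
  nlinarith

lemma le_H_of_G'_eq {t : ℝ} (ht : M.G' t = t) {χ : 𝒜 × 𝒲 → Fin K} (hχ : Measurable χ) :
    t ≤ M.H χ := by
  have h1 := integral_excess_m'_le (M := M) t hχ
  rw [(G'_eq_iff t).1 ht, integral_excess t hχ] at h1
  have h2 := integral_negLogA_selection_pos (M := M) hχ
  by_contra! h
  nlinarith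

lemma supH_eq {t : ℝ} (ht : M.G t = t) : M.supH = t :=
  le_antisymm (iSup_le fun χ => EReal.coe_le_coe_iff.2 (H_le_of_G_eq ht χ.2))
    (le_iSup_of_le ⟨M.m t, M.measurable_m t⟩ (EReal.coe_le_coe_iff.2 ht.ge))

lemma supG_eq {t : ℝ} (h0 : 0 ≤ t) (ht : M.G t = t) : M.supG = t :=
  le_antisymm (iSup_le fun θ => EReal.coe_le_coe_iff.2 (H_le_of_G_eq ht (M.measurable_m θ.1)))
    (le_iSup_of_le ⟨t, h0⟩ (EReal.coe_le_coe_iff.2 ht.ge))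

lemma infH_eq {t : ℝ} (ht : M.G' t = t) : M.infH = t :=
  le_antisymm (iInf_le_of_le ⟨M.m' t, M.measurable_m' t⟩ (EReal.coe_le_coe_iff.2 ht.le))
    (le_iInf fun χ => EReal.coe_le_coe_iff.2 (le_H_of_G'_eq ht χ.2))

lemma infG'_eq {t : ℝ} (h0 : 0 ≤ t) (ht : M.G' t = t) : M.infG' = t :=
  le_antisymm (iInf_le_of_le ⟨t, h0⟩ (EReal.coe_le_coe_iff.2 ht.le))
    (le_iInf fun θ => EReal.coe_le_coe_iff.2 (le_H_of_G'_eq ht (M.measurable_m' θ.1)))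

end RandomMoranModel

/-! ### Balls and Moran intervals -/

namespace RandomMoranModel

variable {K : ℕ} {𝒜 𝒲 : Type*} [MeasurableSpace 𝒜] [MeasurableSpace 𝒲]
  (M : RandomMoranModel K 𝒜 𝒲) (ω : ℕ → 𝒜 × 𝒲) (w : ℕ → Fin K)

/-- The length of the Moran interval of level `n` along the address `w`. -/
def len (n : ℕ) : ℝ := ∏ k ∈ Finset.range n, M.a (w k) (ω k).1

/-- The mass of the Moran interval of level `n` along the address `w`. -/
def mass (n : ℕ) : ℝ := ∏ k ∈ Finset.range n, M.p (w k) (ω k).2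

lemma len_pos (n : ℕ) : 0 < M.len ω w n := M.prod_pos ω w n

lemma len_le (n : ℕ) : M.len ω w n ≤ M.B ^ n := M.prod_le ω w n

lemma len_zero : M.len ω w 0 = 1 := by simp [len]

lemma len_succ (n : ℕ) : M.len ω w (n + 1) = M.len ω w n * M.a (w n) (ω n).1 :=
  Finset.prod_range_succ _ _

lemma A_mul_len_le (n : ℕ) : M.A * M.len ω w n ≤ M.len ω w (n + 1) := by
  rw [len_succ, mul_comm]
  exact mul_le_mul_of_nonneg_left (M.A_le _ _) (M.len_pos ω w n).le

lemma len_antitone : Antitone (M.len ω w) := by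
  refine antitone_nat_of_succ_le fun n => ?_
  rw [len_succ]
  exact mul_le_of_le_one_right (M.len_pos ω w n).le ((M.a_le _ _).trans M.B_lt_one.le)

lemma tendsto_len : Tendsto (M.len ω w) atTop (𝓝 0) :=
  squeeze_zero (fun n => (M.len_pos ω w n).le) (M.len_le ω w)
    (tendsto_pow_atTop_nhds_zero_of_lt_one M.B_pos.le M.B_lt_one)

lemma prod_range_div_prod_range {f : ℕ → ℝ} (hf : ∀ k, 0 < f k) {N n : ℕ} (h : N ≤ n) :
    (∏ k ∈ Finset.range N, f k) / ∏ k ∈ Finset.range n, f k =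
      Real.exp (∑ k ∈ Finset.Ico N n, -Real.log (f k)) := by
  rw [Real.exp_sum, ← Finset.prod_range_mul_prod_Ico _ h, div_mul_eq_div_div,
    div_self (Finset.prod_pos fun k _ => hf k).ne', one_div, ← Finset.prod_inv_distrib]
  exact Finset.prod_congr rfl fun k _ => by rw [Real.exp_neg, Real.exp_log (hf k)]

lemma len_div_len {N n : ℕ} (h : N ≤ n) :
    M.len ω w N / M.len ω w n = Real.exp (∑ k ∈ Finset.Ico N n, M.negLogA (w k) (ω k)) :=
  prod_range_div_prod_range (fun _ => M.a_pos _ _) h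

lemma len_div_len_le (N n : ℕ) : M.len ω w N / M.len ω w n ≤ (M.A ^ (n - N))⁻¹ := by
  rw [div_le_iff₀ (M.len_pos ω w n), inv_mul_eq_div, le_div_iff₀ (pow_pos M.A_pos _)]
  rcases le_total n N with h | h
  · simpa [Nat.sub_eq_zero_of_le h] using M.len_antitone ω w h
  · obtain ⟨j, rfl⟩ := Nat.exists_eq_add_of_le h
    rw [Nat.add_sub_cancel_left]
    clear h
    induction j with
    | zero => simp
    | succ j ih =>
      calc M.len ω w N * M.A ^ (j + 1) = M.A * (M.len ω w N * M.A ^ j) := by ring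
        _ ≤ M.A * M.len ω w (N + j) := mul_le_mul_of_nonneg_left ih M.A_pos.le
        _ ≤ _ := M.A_mul_len_le ω w (N + j)

lemma tau_lt_one : M.τ < 1 := by
  refine M.τ_le.trans_lt ?_
  have hK : (2 : ℝ) ≤ K := by exact_mod_cast M.two_le
  rw [div_lt_one (by linarith)]
  linarith [M.B_pos]

/-- For every scale there is a first level at which the intervals are, up to the factor `c`,
shorter than it. -/
lemma exists_first_level {c ρ : ℝ} (hρ : 0 < ρ) :
    ∃ n, c * M.len ω w n < ρ ∧ ∀ j < n, ρ ≤ c * M.len ω w j := by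
  have h : ∃ n, c * M.len ω w n < ρ := by
    have := (M.tendsto_len ω w).const_mul c
    rw [mul_zero] at this
    exact (this.eventually_lt_const hρ).exists
  classical
  exact ⟨Nat.find h, Nat.find_spec h, fun j hj => not_lt.1 (Nat.find_min h hj)⟩

/-- Two points of the Moran set whose distance is below the gap at level `n` have addresses that
agree up to the letter with number `n`. -/
lemma eq_of_abs_point_sub_lt {v : ℕ → Fin K} {n : ℕ}
    (h : |M.point ω v - M.point ω w| < M.τ * M.len ω w n) : ∀ k ≤ n, v k = w k := by
  intro k
  induction k using Nat.strong_induction_on with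
  | _ k ih =>
    intro hk
    by_contra hne
    obtain ⟨y, hy, hyv⟩ := M.point_mem ω v (k + 1)
    obtain ⟨z, hz, hzw⟩ := M.point_mem ω w (k + 1)
    simp only [comp, Function.comp] at hyv hzw
    rw [M.comp_congr ω k fun j hj => ih j hj (by omega)] at hyv
    have h1 := M.abs_comp_sub ω w k _ (M.S_mapsTo (v k) (ω k).1 hy) _
      (M.S_mapsTo (w k) (ω k).1 hz)
    rw [hyv, hzw] at h1
    have h2 := mul_le_mul_of_nonneg_left (M.separated (ω k).1 _ _ hne y hy z hz)
      (M.len_pos ω w k).le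
    have h3 := mul_le_mul_of_nonneg_left (M.len_antitone ω w hk) M.τ_pos.le
    rw [← len] at h1
    linarith

lemma moranMeasure_real_moranInterval (n : ℕ) :
    (M.moranMeasure ω).real (M.moranInterval ω w n) = M.mass ω w n := by
  rw [Measure.real, moranMeasure_moranInterval, ENNReal.toReal_prod]
  exact Finset.prod_congr rfl fun k _ => ENNReal.toReal_ofReal (M.p_nonneg _ _)

/-- A ball around a point of the Moran set whose radius is below the gaps of the previous levels
has at most the mass of the interval of level `n`. -/
lemma measure_ball_le_mass {n : ℕ} {r : ℝ} (h : ∀ j < n, r ≤ M.τ * M.len ω w j) :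
    (M.moranMeasure ω).real (Metric.ball (M.point ω w) r) ≤ M.mass ω w n := by
  rw [← moranMeasure_real_moranInterval]
  refine ENNReal.toReal_mono (measure_ne_top _ _) ?_
  rw [moranMeasure, Measure.map_apply (M.measurable_point ω) Metric.isOpen_ball.measurableSet,
    Measure.map_apply (M.measurable_point ω) (M.isClosed_moranInterval ω w n).measurableSet]
  refine measure_mono fun v hv => (M.point_mem_iff ω w v n).2 fun k hk => ?_
  rw [mem_preimage, Metric.mem_ball, Real.dist_eq] at hv
  exact M.eq_of_abs_point_sub_lt ω w (hv.trans_le (h k hk)) k le_rfl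

lemma moranInterval_subset_ball {n : ℕ} {r : ℝ} (h : M.len ω w n < r) :
    M.moranInterval ω w n ⊆ Metric.ball (M.point ω w) r := by
  rintro _ ⟨x, hx, rfl⟩
  obtain ⟨z, hz, hzw⟩ := M.point_mem ω w n
  rw [Metric.mem_ball, Real.dist_eq, ← hzw, M.abs_comp_sub ω w n x hx z hz, ← len]
  refine (mul_le_of_le_one_right (M.len_pos ω w n).le ?_).trans_lt h
  rw [abs_le]
  constructor <;> linarith [hx.1, hx.2, hz.1, hz.2]

lemma mass_le_measure_ball {n : ℕ} {r : ℝ} (h : M.len ω w n < r) :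
    M.mass ω w n ≤ (M.moranMeasure ω).real (Metric.ball (M.point ω w) r) := by
  rw [← moranMeasure_real_moranInterval]
  exact measureReal_mono (M.moranInterval_subset_ball ω w h)

variable {ω}

lemma mass_pos (hp : ∀ k j, 0 < M.p j (ω k).2) (n : ℕ) : 0 < M.mass ω w n :=
  Finset.prod_pos fun k _ => hp k (w k)

lemma mass_div_mass (hp : ∀ k j, 0 < M.p j (ω k).2) {N n : ℕ} (h : N ≤ n) :
    M.mass ω w N / M.mass ω w n = Real.exp (∑ k ∈ Finset.Ico N n, M.negLogP (w k) (ω k)) :=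
  prod_range_div_prod_range (fun _ => hp _ _) h

lemma measure_ball_pos (hp : ∀ k j, 0 < M.p j (ω k).2) {r : ℝ} (hr : 0 < r) :
    0 < (M.moranMeasure ω).real (Metric.ball (M.point ω w) r) := by
  obtain ⟨n, hn, -⟩ := M.exists_first_level ω w (c := 1) hr
  rw [one_mul] at hn
  exact (M.mass_pos w hp n).trans_le (M.mass_le_measure_ball ω w hn)

lemma point_mem_support (hp : ∀ k j, 0 < M.p j (ω k).2) :
    M.point ω w ∈ (M.moranMeasure ω).support := by
  rw [Metric.nhds_basis_ball.mem_measureSupport]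
  exact fun r hr => (ENNReal.toReal_pos_iff.1 (M.measure_ball_pos w hp hr)).1

/-- The support is contained in the Moran set, all of whose points have an address. -/
lemma exists_point_eq_of_mem_support {x : ℝ} (hx : x ∈ (M.moranMeasure ω).support) :
    ∃ w, x = M.point ω w := by
  have hx' : x ∈ M.moranSet ω := Measure.support_subset_of_isClosed (M.isClosed_moranSet ω)
    (mem_ae_iff.2 (M.moranMeasure_compl_moranSet ω)) hx
  choose v hv using fun n => mem_iUnion.1 (mem_iInter.1 hx' n)
  -- the addresses found at the different levels are compatible, so they have a common extension
  have hw : ∀ n, x ∈ M.moranInterval ω (fun k => v (k + 1) k) n := fun n => by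
    have h : ∀ k < n, v n k = v (k + 1) k := fun k hk => by
      have hanti : M.moranInterval ω (v n) n ⊆ M.moranInterval ω (v n) (k + 1) :=
        antitone_nat_of_succ_le (M.moranInterval_succ_subset ω (v n)) (by omega)
      exact M.eq_of_mem ω (k + 1) (hanti (hv n)) (hv (k + 1)) k (by omega)
    have h1 := hv n
    rwa [moranInterval, M.comp_congr ω n h] at h1
  refine ⟨fun k => v (k + 1) k, eq_of_forall_dist_le fun r hr => ?_⟩
  obtain ⟨n, hn, -⟩ := M.exists_first_level ω (fun k => v (k + 1) k) (c := 1) hr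
  rw [one_mul] at hn
  exact (Metric.mem_ball.1 (M.moranInterval_subset_ball ω _ hn (hw n))).le

end RandomMoranModel

/-! ### Admissible exponents -/

/-- A large dimension function forces the ratio of the two radii to exceed every power of the
logarithm of the larger one. -/
lemma IsLargeDimensionFunction.exists_mul_log_abs_log_le {Φ : ℝ → ℝ}
    (hΦ : IsLargeDimensionFunction Φ) (D L₀ : ℝ) :
    ∃ C₁ > 0, ∀ r R : ℝ, 0 < r → r < R ^ (1 + Φ R) → R ^ (1 + Φ R) ≤ R → R ≤ C₁ →
      0 < R ∧ L₀ ≤ -Real.log R ∧ D * Real.log (-Real.log R) ≤ Real.log (R / r) := by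
  obtain ⟨h, hh, hlarge⟩ := hΦ.large
  have hlog : ∀ᶠ t in 𝓝[>] (0 : ℝ), max L₀ 1 ≤ -Real.log t :=
    (tendsto_neg_atBot_atTop.comp Real.tendsto_log_nhdsGT_zero).eventually_ge_atTop _
  obtain ⟨ε, hε, hmem⟩ := mem_nhdsGT_iff_exists_Ioo_subset.1
    (hlarge.and ((hh.eventually_ge_atTop D).and hlog))
  have hε0 : (0 : ℝ) < ε := hε
  refine ⟨ε / 2, half_pos hε0, fun r R hr hrR hRR hRC => ?_⟩
  have hR : 0 < R := hr.trans (hrR.trans_le hRR)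
  obtain ⟨h1, h2, h3⟩ := hmem ⟨hR, by linarith⟩
  refine ⟨hR, (le_max_left _ _).trans h3, ?_⟩
  have h3' : 1 ≤ -Real.log R := (le_max_right _ _).trans h3
  have h4 : Real.log r < (1 + Φ R) * Real.log R := by
    rw [← Real.log_rpow hR]
    exact Real.log_lt_log hr hrR
  have h5 : Φ R * -Real.log R = h R * Real.log (-Real.log R) := by
    rw [h1, abs_of_nonpos (by linarith), mul_assoc,
      div_mul_cancel₀ _ (by linarith)]
  rw [Real.log_div hR.ne' hr.ne']
  have h6 := mul_le_mul_of_nonneg_right h2 (Real.log_nonneg h3')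
  linarith

namespace RandomMoranModel

variable {K : ℕ} {𝒜 𝒲 : Type*} [MeasurableSpace 𝒜] [MeasurableSpace 𝒲]
  (M : RandomMoranModel K 𝒜 𝒲)

/-- For a large dimension function, the levels `N` and `n` that correspond to the radii `R` and
`r` differ by at least any given multiple of `log N`. -/
lemma exists_level_gap {Φ : ℝ → ℝ} (hΦ : IsLargeDimensionFunction Φ) {c D : ℝ} (hc : 0 < c)
    (hD : 0 ≤ D) :
    ∃ C₁ > 0, ∀ r R : ℝ, 0 < r → r < R ^ (1 + Φ R) → R ^ (1 + Φ R) ≤ R → R ≤ C₁ →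
      ∀ N n : ℕ, R ≤ M.B ^ N / M.B → R / r ≤ c * (M.A ^ (n - N))⁻¹ →
        N ≤ n ∧ N + D * Real.log (N + 1) ≤ n := by
  have hb := M.neg_log_B_pos
  set b := -Real.log M.B with hb_def
  have hα : 0 < -Real.log M.A := by
    have i0 : Fin K := ⟨0, by have := M.two_le; omega⟩
    have hA : M.A < 1 := by
      have hK : (2 : ℝ) ≤ K := by exact_mod_cast M.two_le
      nlinarith [M.KA_le, M.B_lt_one, M.A_pos]
    exact neg_pos.2 (Real.log_neg M.A_pos hA)
  set α := -Real.log M.A with hα_def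
  -- The factor `2 * D * α` serves because `N + 1` is at most the square of `L = |log R|`; the
  -- surplus `log L` absorbs the constant `c`.
  obtain ⟨C₁, hC₁, hgap⟩ := hΦ.exists_mul_log_abs_log_le (2 * (D * α) + 1) (1 / b + 2 + c)
  refine ⟨C₁, hC₁, fun r R hr hrR hRR hRC N n hRN hRr => ?_⟩
  obtain ⟨hR, hL, hD'⟩ := hgap r R hr hrR hRR hRC
  set L := -Real.log R with hL_def
  have hb1 : 0 < 1 / b := by positivity
  have hL1 : 1 < L := by linarith
  have hlogL : Real.log c < Real.log L := Real.log_lt_log hc (by linarith)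
  have hup : Real.log (R / r) ≤ Real.log c + ((n - N : ℕ) : ℝ) * α := by
    have h := Real.log_le_log (div_pos hR hr) hRr
    rw [Real.log_mul hc.ne' (inv_pos.2 (pow_pos M.A_pos _)).ne', Real.log_inv, Real.log_pow] at h
    rw [hα_def]
    linarith
  have hNL : ((N : ℝ) - 1) * b ≤ L := by
    have h := Real.log_le_log hR hRN
    rw [Real.log_div (pow_pos M.B_pos N).ne' M.B_pos.ne', Real.log_pow] at h
    rw [hL_def, hb_def]
    linarith
  have hN2 : (N : ℝ) + 1 ≤ L ^ 2 := by
    have h1 : (N : ℝ) - 1 ≤ L * (1 / b) := by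
      rw [mul_one_div, le_div_iff₀ hb]
      exact hNL
    nlinarith
  have hlogN : Real.log (N + 1) ≤ 2 * Real.log L := by
    have h := Real.log_le_log (by positivity) hN2
    rw [Real.log_pow] at h
    exact_mod_cast h
  have hlogN0 : 0 ≤ Real.log ((N : ℝ) + 1) :=
    Real.log_nonneg (by linarith [(Nat.cast_nonneg N : (0 : ℝ) ≤ N)])
  have hmain : D * Real.log (N + 1) < ((n - N : ℕ) : ℝ) := by
    have h1 := mul_le_mul_of_nonneg_left hlogN (mul_nonneg hD hα.le)
    have h2 : D * Real.log (N + 1) * α < ((n - N : ℕ) : ℝ) * α := by nlinarith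
    exact lt_of_mul_lt_mul_right h2 hα.le
  have hNn : N ≤ n := by
    by_contra! h
    rw [Nat.sub_eq_zero_of_le h.le, Nat.cast_zero] at hmain
    linarith [mul_nonneg hD hlogN0]
  rw [Nat.cast_sub hNn] at hmain
  exact ⟨hNn, by linarith⟩

variable {M} {ω : ℕ → 𝒜 × 𝒲}

/-- If the block sums of the maximal excess are bounded above, the exponent is admissible in the
definition of the upper dimension. -/
lemma exists_upper_bound_of_sum_le {Φ : ℝ → ℝ} (hΦ : IsLargeDimensionFunction Φ)
    (hp : ∀ k j, 0 < M.p j (ω k).2) {d D C : ℝ} (hd : 0 ≤ d) (hD : 0 ≤ D)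
    (hC : ∀ N n : ℕ, N + D * Real.log (N + 1) ≤ n →
      ∑ k ∈ Finset.Ico N n, M.excess d (M.m d) (ω k) ≤ C) :
    ∃ C₁ > 0, ∃ C₂ > 0, ∀ r R : ℝ,
      0 < r → r < R ^ (1 + Φ R) → R ^ (1 + Φ R) ≤ R → R ≤ C₁ → R < 1 →
      ∀ x ∈ (M.moranMeasure ω).support, (M.moranMeasure ω).real (Metric.ball x R) /
        (M.moranMeasure ω).real (Metric.ball x r) ≤ C₂ * (R / r) ^ d := by
  have hA := M.A_pos
  have hτ := M.τ_pos
  obtain ⟨C₁, hC₁, hgap⟩ := M.exists_level_gap hΦ (c := 1 / M.A) (by positivity) hD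
  refine ⟨C₁, hC₁, Real.exp C * (1 / (M.τ * M.A)) ^ d, by positivity, ?_⟩
  intro r R hr hrR hRR hRC hR1 x hx
  have hR : 0 < R := hr.trans (hrR.trans_le hRR)
  obtain ⟨w, rfl⟩ := M.exists_point_eq_of_mem_support hx
  -- the large ball meets only the interval of level `N`, the small one contains that of level `n`
  obtain ⟨N, hN, hN'⟩ := M.exists_first_level ω w (c := M.τ) hR
  obtain ⟨n, hn, hn'⟩ := M.exists_first_level ω w (c := 1) hr
  rw [one_mul] at hn
  simp only [one_mul] at hn'
  have hlenN := M.len_pos ω w N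
  have hlenn := M.len_pos ω w n
  have hRN : R ≤ M.len ω w N / M.A ∧ R ≤ M.B ^ N / M.B := by
    rcases N with _ | N
    · rw [len_zero, pow_zero]
      exact ⟨hR1.le.trans ((one_le_div hA).2 ((M.A_le (w 0) (ω 0).1).trans
        ((M.a_le _ _).trans M.B_lt_one.le))), hR1.le.trans ((one_le_div M.B_pos).2 M.B_lt_one.le)⟩
    · have h1 : R ≤ M.len ω w N := (hN' N N.lt_succ_self).trans
        (mul_le_of_le_one_left (M.len_pos ω w N).le M.tau_lt_one.le)
      constructor
      · rw [le_div_iff₀ hA, mul_comm]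
        exact (mul_le_mul_of_nonneg_left h1 hA.le).trans (M.A_mul_len_le ω w N)
      · rw [pow_succ, mul_div_cancel_right₀ _ M.B_pos.ne']
        exact h1.trans (M.len_le ω w N)
  obtain ⟨hNn, hNn'⟩ := hgap r R hr hrR hRR hRC N n hRN.2 <| by
    calc R / r ≤ M.len ω w N / M.A / M.len ω w n := by
          have := hRN.1
          gcongr
      _ = 1 / M.A * (M.len ω w N / M.len ω w n) := by ring
      _ ≤ _ := by
          have := M.len_div_len_le ω w N n
          gcongr
  have hlow : M.len ω w N / M.len ω w n ≤ 1 / (M.τ * M.A) * (R / r) := by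
    obtain ⟨n, rfl⟩ : ∃ j, n = j + 1 := by
      rcases n with _ | n
      · rw [len_zero] at hn
        linarith [hrR.trans_le hRR]
      · exact ⟨n, rfl⟩
    have h1 : M.A * r ≤ M.len ω w (n + 1) :=
      (mul_le_mul_of_nonneg_left (hn' n n.lt_succ_self) hA.le).trans (M.A_mul_len_le ω w n)
    calc M.len ω w N / M.len ω w (n + 1) ≤ R / M.τ / (M.A * r) := by
          gcongr
          rw [le_div_iff₀ hτ, mul_comm]
          exact hN.le
      _ = _ := by
          field_simp
  have hmax : ∑ k ∈ Finset.Ico N n, M.negLogP (w k) (ω k) ≤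
      C + (∑ k ∈ Finset.Ico N n, M.negLogA (w k) (ω k)) * d := by
    have h1 : ∑ k ∈ Finset.Ico N n, (M.negLogP (w k) (ω k) - d * M.negLogA (w k) (ω k)) ≤ C :=
      (Finset.sum_le_sum fun k _ => le_excess_m d (hp k) (w k)).trans (hC N n hNn')
    rw [Finset.sum_sub_distrib, ← Finset.mul_sum] at h1
    linarith
  calc _ ≤ M.mass ω w N / M.mass ω w n := by
        have h1 := M.measure_ball_le_mass ω w hN'
        have h2 := M.mass_le_measure_ball ω w hn
        have h3 := M.mass_pos w hp n
        have h4 := (M.mass_pos w hp N).le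
        gcongr
    _ = Real.exp (∑ k ∈ Finset.Ico N n, M.negLogP (w k) (ω k)) := M.mass_div_mass w hp hNn
    _ ≤ Real.exp C * (M.len ω w N / M.len ω w n) ^ d := by
        rw [M.len_div_len ω w hNn, ← Real.exp_mul, ← Real.exp_add]
        exact Real.exp_le_exp.2 hmax
    _ ≤ Real.exp C * (1 / (M.τ * M.A) * (R / r)) ^ d := by gcongr
    _ = _ := by rw [Real.mul_rpow (by positivity) (by positivity), mul_assoc]

/-- If the block sums of the minimal excess are bounded below, the exponent is admissible in the
definition of the lower dimension. -/
lemma exists_lower_bound_of_le_sum {Φ : ℝ → ℝ} (hΦ : IsLargeDimensionFunction Φ)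
    (hp : ∀ k j, 0 < M.p j (ω k).2) {d D C : ℝ} (hd : 0 ≤ d) (hD : 0 ≤ D)
    (hC : ∀ N n : ℕ, N + D * Real.log (N + 1) ≤ n →
      C ≤ ∑ k ∈ Finset.Ico N n, M.excess d (M.m' d) (ω k)) :
    ∃ C₁ > 0, ∃ C₂ > 0, ∀ r R : ℝ,
      0 < r → r < R ^ (1 + Φ R) → R ^ (1 + Φ R) ≤ R → R ≤ C₁ → R < 1 →
      ∀ x ∈ (M.moranMeasure ω).support, C₂ * (R / r) ^ d ≤
        (M.moranMeasure ω).real (Metric.ball x R) /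
          (M.moranMeasure ω).real (Metric.ball x r) := by
  have hA := M.A_pos
  have hτ := M.τ_pos
  obtain ⟨C₁, hC₁, hgap⟩ := M.exists_level_gap hΦ (c := 1 / (M.τ * M.A)) (by positivity) hD
  refine ⟨C₁, hC₁, Real.exp C * (M.τ * M.A) ^ d, by positivity, ?_⟩
  intro r R hr hrR hRR hRC hR1 x hx
  have hR : 0 < R := hr.trans (hrR.trans_le hRR)
  obtain ⟨w, rfl⟩ := M.exists_point_eq_of_mem_support hx
  -- the large ball contains the interval of level `N`, the small one meets only that of level `n`
  obtain ⟨N, hN, hN'⟩ := M.exists_first_level ω w (c := 1) hR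
  obtain ⟨n, hn, hn'⟩ := M.exists_first_level ω w (c := M.τ) hr
  rw [one_mul] at hN
  simp only [one_mul] at hN'
  have hlenN := M.len_pos ω w N
  have hlenn := M.len_pos ω w n
  have hRN : R ≤ M.len ω w N / M.A ∧ R ≤ M.B ^ N / M.B := by
    rcases N with _ | N
    · rw [len_zero] at hN
      linarith
    · have h1 : R ≤ M.len ω w N := hN' N N.lt_succ_self
      constructor
      · rw [le_div_iff₀ hA, mul_comm]
        exact (mul_le_mul_of_nonneg_left h1 hA.le).trans (M.A_mul_len_le ω w N)
      · rw [pow_succ, mul_div_cancel_right₀ _ M.B_pos.ne']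
        exact h1.trans (M.len_le ω w N)
  have hup : M.τ * M.A * (R / r) ≤ M.len ω w N / M.len ω w n := by
    calc M.τ * M.A * (R / r) ≤ M.τ * M.A * (M.len ω w N / M.A / (M.τ * M.len ω w n)) := by
          have := hRN.1
          gcongr
      _ = _ := by field_simp
  obtain ⟨hNn, hNn'⟩ := hgap r R hr hrR hRR hRC N n hRN.2 <| by
    rw [one_div_mul_eq_div, le_div_iff₀ (by positivity), mul_comm]
    exact hup.trans (M.len_div_len_le ω w N n)
  have hmin : C + (∑ k ∈ Finset.Ico N n, M.negLogA (w k) (ω k)) * d ≤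
      ∑ k ∈ Finset.Ico N n, M.negLogP (w k) (ω k) := by
    have h1 : C ≤ ∑ k ∈ Finset.Ico N n, (M.negLogP (w k) (ω k) - d * M.negLogA (w k) (ω k)) :=
      (hC N n hNn').trans (Finset.sum_le_sum fun k _ => excess_m'_le d (hp k) (w k))
    rw [Finset.sum_sub_distrib, ← Finset.mul_sum] at h1
    linarith
  calc _ = Real.exp C * (M.τ * M.A * (R / r)) ^ d := by
        rw [mul_assoc, ← Real.mul_rpow (by positivity) (by positivity)]
    _ ≤ Real.exp C * (M.len ω w N / M.len ω w n) ^ d := by gcongr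
    _ ≤ Real.exp (∑ k ∈ Finset.Ico N n, M.negLogP (w k) (ω k)) := by
        rw [M.len_div_len ω w hNn, ← Real.exp_mul, ← Real.exp_add]
        exact Real.exp_le_exp.2 hmin
    _ = M.mass ω w N / M.mass ω w n := (M.mass_div_mass w hp hNn).symm
    _ ≤ _ := by
        have h1 := M.mass_le_measure_ball ω w hN
        have h2 := M.measure_ball_le_mass ω w hn'
        have h3 := M.measure_ball_pos w hp hr
        have h4 := (M.mass_pos w hp N).le
        gcongr

/-- Negative exponents are always admissible in the definition of the lower dimension, because the
larger ball has the larger mass. -/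
lemma exists_lower_bound_of_neg (Φ : ℝ → ℝ) (hp : ∀ k j, 0 < M.p j (ω k).2) {d : ℝ} (hd : d ≤ 0) :
    ∃ C₁ > 0, ∃ C₂ > 0, ∀ r R : ℝ,
      0 < r → r < R ^ (1 + Φ R) → R ^ (1 + Φ R) ≤ R → R ≤ C₁ → R < 1 →
      ∀ x ∈ (M.moranMeasure ω).support, C₂ * (R / r) ^ d ≤
        (M.moranMeasure ω).real (Metric.ball x R) /
          (M.moranMeasure ω).real (Metric.ball x r) := by
  refine ⟨1, one_pos, 1, one_pos, fun r R hr hrR hRR _ _ x hx => ?_⟩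
  obtain ⟨w, rfl⟩ := M.exists_point_eq_of_mem_support hx
  have hrR' : r ≤ R := (hrR.trans_le hRR).le
  rw [one_mul]
  refine (Real.rpow_le_one_of_one_le_of_nonpos ((one_le_div hr).2 hrR') hd).trans ?_
  rw [one_le_div (M.measure_ball_pos w hp hr)]
  exact measureReal_mono (Metric.ball_subset_ball hrR')

/-- If, along some address, the sums of the excess tend to `∞`, the exponent is not admissible in
the definition of the upper dimension: fix a large ball around the point with this address and
let the radius of the small ball tend to zero. -/
lemma not_exists_upper_bound {Φ : ℝ → ℝ} (hΦ : IsDimensionFunction Φ)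
    (hp : ∀ k j, 0 < M.p j (ω k).2) {d : ℝ} {w : ℕ → Fin K}
    (hsum : Tendsto (fun n => ∑ k ∈ Finset.range n,
      (M.negLogP (w k) (ω k) - d * M.negLogA (w k) (ω k))) atTop atTop) :
    ¬ ∃ C₁ > 0, ∃ C₂ > 0, ∀ r R : ℝ,
      0 < r → r < R ^ (1 + Φ R) → R ^ (1 + Φ R) ≤ R → R ≤ C₁ → R < 1 →
      ∀ x ∈ (M.moranMeasure ω).support, (M.moranMeasure ω).real (Metric.ball x R) /
        (M.moranMeasure ω).real (Metric.ball x r) ≤ C₂ * (R / r) ^ d := by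
  rintro ⟨C₁, hC₁, C₂, hC₂, h⟩
  have hτ := M.τ_pos
  -- the ball of radius `R` contains the interval of level `N`; the small balls will have the
  -- radius `τ * len n`, so that they meet only the interval of level `n`
  obtain ⟨N, hN, -⟩ := M.exists_first_level ω w (c := 2) (lt_min hC₁ one_pos)
  have hlenN := M.len_pos ω w N
  set R := 2 * M.len ω w N with hR_def
  have hR : 0 < R := by positivity
  have hR1 : R < 1 := hN.trans_le (min_le_right _ _)
  have hRR : R ^ (1 + Φ R) ≤ R := by
    simpa using Real.rpow_le_rpow_of_exponent_ge hR hR1.le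
      (le_add_of_nonneg_right (hΦ.nonneg R ⟨hR, hR1⟩) : 1 ≤ 1 + Φ R)
  have hRpos : 0 < R ^ (1 + Φ R) := Real.rpow_pos_of_pos hR _
  have hlen : ∀ᶠ n in atTop, M.τ * M.len ω w n < R ^ (1 + Φ R) := by
    have := (M.tendsto_len ω w).const_mul M.τ
    rw [mul_zero] at this
    exact this.eventually_lt_const hRpos
  obtain ⟨n, hn, hns, hNn⟩ := (hlen.and ((hsum.eventually_gt_atTop
    (Real.log (C₂ * (2 / M.τ) ^ d) + ∑ k ∈ Finset.range N,
      (M.negLogP (w k) (ω k) - d * M.negLogA (w k) (ω k)))).and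
    (eventually_ge_atTop N))).exists
  have hlenn := M.len_pos ω w n
  have hle := h (M.τ * M.len ω w n) R (by positivity) hn hRR (hN.le.trans (min_le_left _ _)) hR1 _
    (M.point_mem_support w hp)
  rw [← Finset.sum_range_add_sum_Ico _ hNn, Finset.sum_sub_distrib (s := Finset.Ico N n),
    ← Finset.mul_sum] at hns
  have h1 : Real.exp (∑ k ∈ Finset.Ico N n, M.negLogP (w k) (ω k)) ≤
      C₂ * (2 / M.τ) ^ d * Real.exp (d * ∑ k ∈ Finset.Ico N n, M.negLogA (w k) (ω k)) := by
    calc _ = M.mass ω w N / M.mass ω w n := (M.mass_div_mass w hp hNn).symm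
      _ ≤ _ := by
          have h1 := M.mass_le_measure_ball ω w (n := N) (r := R) (by linarith)
          have h2 := M.measure_ball_le_mass ω w (n := n) (r := M.τ * M.len ω w n)
            fun j hj => mul_le_mul_of_nonneg_left (M.len_antitone ω w hj.le) hτ.le
          have h3 := M.measure_ball_pos w hp (r := M.τ * M.len ω w n) (by positivity)
          have h4 := (M.mass_pos w hp N).le
          exact div_le_div₀ (h4.trans h1) h1 h3 h2
      _ ≤ _ := hle
      _ = C₂ * ((2 / M.τ) * (M.len ω w N / M.len ω w n)) ^ d := by
          rw [hR_def]
          congr 2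
          field_simp
      _ = _ := by
          rw [Real.mul_rpow (by positivity) (by positivity), M.len_div_len ω w hNn,
            ← Real.exp_mul, mul_comm d, mul_assoc]
  rw [← Real.exp_log (by positivity : 0 < C₂ * (2 / M.τ) ^ d), ← Real.exp_add,
    Real.exp_le_exp] at h1
  linarith

/-- If, along some address, the sums of the excess tend to `-∞`, the exponent is not admissible in
the definition of the lower dimension. -/
lemma not_exists_lower_bound {Φ : ℝ → ℝ} (hΦ : IsDimensionFunction Φ)
    (hp : ∀ k j, 0 < M.p j (ω k).2) {d : ℝ} {w : ℕ → Fin K}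
    (hsum : Tendsto (fun n => ∑ k ∈ Finset.range n,
      (M.negLogP (w k) (ω k) - d * M.negLogA (w k) (ω k))) atTop atBot) :
    ¬ ∃ C₁ > 0, ∃ C₂ > 0, ∀ r R : ℝ,
      0 < r → r < R ^ (1 + Φ R) → R ^ (1 + Φ R) ≤ R → R ≤ C₁ → R < 1 →
      ∀ x ∈ (M.moranMeasure ω).support, C₂ * (R / r) ^ d ≤
        (M.moranMeasure ω).real (Metric.ball x R) /
          (M.moranMeasure ω).real (Metric.ball x r) := by
  rintro ⟨C₁, hC₁, C₂, hC₂, h⟩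
  have hτ := M.τ_pos
  -- the ball of radius `R` meets only the interval of level `N`; the small balls will have the
  -- radius `2 * len n`, so that they contain the interval of level `n`
  obtain ⟨N, hN, -⟩ := M.exists_first_level ω w (c := M.τ) (lt_min hC₁ one_pos)
  have hlenN := M.len_pos ω w N
  set R := M.τ * M.len ω w N with hR_def
  have hR : 0 < R := by positivity
  have hR1 : R < 1 := hN.trans_le (min_le_right _ _)
  have hRR : R ^ (1 + Φ R) ≤ R := by
    simpa using Real.rpow_le_rpow_of_exponent_ge hR hR1.le
      (le_add_of_nonneg_right (hΦ.nonneg R ⟨hR, hR1⟩) : 1 ≤ 1 + Φ R)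
  have hRpos : 0 < R ^ (1 + Φ R) := Real.rpow_pos_of_pos hR _
  have hlen : ∀ᶠ n in atTop, 2 * M.len ω w n < R ^ (1 + Φ R) := by
    have := (M.tendsto_len ω w).const_mul 2
    rw [mul_zero] at this
    exact this.eventually_lt_const hRpos
  obtain ⟨n, hn, hns, hNn⟩ := (hlen.and ((hsum.eventually_lt_atBot
    (Real.log (C₂ * (M.τ / 2) ^ d) + ∑ k ∈ Finset.range N,
      (M.negLogP (w k) (ω k) - d * M.negLogA (w k) (ω k)))).and
    (eventually_ge_atTop N))).exists
  have hlenn := M.len_pos ω w n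
  have hle := h (2 * M.len ω w n) R (by positivity) hn hRR (hN.le.trans (min_le_left _ _)) hR1 _
    (M.point_mem_support w hp)
  rw [← Finset.sum_range_add_sum_Ico _ hNn, Finset.sum_sub_distrib (s := Finset.Ico N n),
    ← Finset.mul_sum] at hns
  have h1 : C₂ * (M.τ / 2) ^ d * Real.exp (d * ∑ k ∈ Finset.Ico N n, M.negLogA (w k) (ω k)) ≤
      Real.exp (∑ k ∈ Finset.Ico N n, M.negLogP (w k) (ω k)) := by
    calc _ = C₂ * ((M.τ / 2) * (M.len ω w N / M.len ω w n)) ^ d := by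
          rw [Real.mul_rpow (by positivity) (by positivity), M.len_div_len ω w hNn,
            ← Real.exp_mul, mul_comm d, mul_assoc]
      _ = C₂ * (R / (2 * M.len ω w n)) ^ d := by
          rw [hR_def]
          congr 2
          field_simp
      _ ≤ _ := hle
      _ ≤ M.mass ω w N / M.mass ω w n := by
          have h1 := M.measure_ball_le_mass ω w (n := N) (r := R)
            fun j hj => mul_le_mul_of_nonneg_left (M.len_antitone ω w hj.le) hτ.le
          have h2 := M.mass_le_measure_ball ω w (n := n) (r := 2 * M.len ω w n) (by linarith)
          exact div_le_div₀ (M.mass_pos w hp N).le h1 (M.mass_pos w hp n) h2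
      _ = _ := M.mass_div_mass w hp hNn
  rw [← Real.exp_log (by positivity : 0 < C₂ * (M.τ / 2) ^ d), ← Real.exp_add,
    Real.exp_le_exp] at h1
  linarith

end RandomMoranModel

/-! ### The almost sure dimensions -/

namespace RandomMoranModel

variable {K : ℕ} {𝒜 𝒲 : Type*} [MeasurableSpace 𝒜] [MeasurableSpace 𝒲]
  {M : RandomMoranModel K 𝒜 𝒲}

lemma ae_law_p_pos : ∀ᵐ ω ∂M.law, ∀ k j, 0 < M.p j (ω k).2 :=
  ae_all_iff.2 fun k =>
    (measurePreserving_eval_infinitePi (fun _ : ℕ => M.P) k).quasiMeasurePreserving.ae M.ae_p_pos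

/-- The law of large numbers along the random address selected by `χ`: one null set serves for all
exponents, since weights and ratios are averaged separately. -/
lemma ae_tendsto_sum_excess {χ : 𝒜 × 𝒲 → Fin K} (hχ : Measurable χ) :
    ∀ᵐ ω ∂M.law,
      (∀ d < M.H χ, Tendsto (fun n => ∑ k ∈ Finset.range n, (M.negLogP (χ (ω k)) (ω k) -
        d * M.negLogA (χ (ω k)) (ω k))) atTop atTop) ∧
      (∀ d > M.H χ, Tendsto (fun n => ∑ k ∈ Finset.range n, (M.negLogP (χ (ω k)) (ω k) -
        d * M.negLogA (χ (ω k)) (ω k))) atTop atBot) := by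
  filter_upwards [ae_tendsto_sum_range_div (measurable_selection M.measurable_negLogP hχ)
    (integrable_negLogP_selection hχ), ae_tendsto_sum_range_div
    (measurable_selection M.measurable_negLogA hχ) (integrable_negLogA_selection hχ)] with ω hP hA
  have hpos := integral_negLogA_selection_pos (M := M) hχ
  have hlim : ∀ d, Tendsto (fun n : ℕ => (∑ k ∈ Finset.range n, (M.negLogP (χ (ω k)) (ω k) -
      d * M.negLogA (χ (ω k)) (ω k))) / n) atTop
      (𝓝 ((M.H χ - d) * ∫ l, M.negLogA (χ l) l ∂M.P)) := fun d => by
    rw [← integral_excess d hχ]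
    simp only [excess]
    rw [integral_sub (integrable_negLogP_selection hχ)
      ((integrable_negLogA_selection hχ).const_mul d), integral_const_mul]
    refine (hP.sub (hA.const_mul d)).congr fun n => ?_
    rw [Finset.sum_sub_distrib, ← Finset.mul_sum]
    ring
  have hmul : ∀ d, (fun n : ℕ => (n : ℝ) * ((∑ k ∈ Finset.range n, (M.negLogP (χ (ω k)) (ω k) -
      d * M.negLogA (χ (ω k)) (ω k))) / n)) =ᶠ[atTop] fun n => ∑ k ∈ Finset.range n,
      (M.negLogP (χ (ω k)) (ω k) - d * M.negLogA (χ (ω k)) (ω k)) := fun d => by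
    filter_upwards [eventually_gt_atTop 0] with n hn
    have : (n : ℝ) ≠ 0 := by exact_mod_cast hn.ne'
    field_simp
  exact ⟨fun d hd => (tendsto_natCast_atTop_atTop.atTop_mul_pos
      (mul_pos (sub_pos.2 hd) hpos) (hlim d)).congr' (hmul d),
    fun d hd => (tendsto_natCast_atTop_atTop.atTop_mul_neg
      (mul_neg_of_neg_of_pos (sub_neg.2 hd) hpos) (hlim d)).congr' (hmul d)⟩

/-- Above the fixed point of `G` the maximal excess has negative mean. -/
lemma ae_sum_excess_m_le {t d : ℝ} (ht : M.G t = t) (hd : t < d) :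
    ∃ D : ℝ, 0 ≤ D ∧ ∀ᵐ ω ∂M.law, ∃ C : ℝ, ∀ N n : ℕ, N + D * Real.log (N + 1) ≤ n →
      ∑ k ∈ Finset.Ico N n, M.excess d (M.m d) (ω k) ≤ C := by
  have hm := M.measurable_m d
  obtain ⟨s, hs, hexp⟩ := exists_integrable_exp_abs_excess (M := M) d hm
  refine ae_exists_bound_sum_Ico (measurable_excess d hm) hs hexp ?_
  rw [integral_excess d hm]
  exact mul_neg_of_neg_of_pos (by linarith [H_le_of_G_eq ht hm])
    (integral_negLogA_selection_pos hm)

/-- Below the fixed point of `G'` the minimal excess has positive mean. -/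
lemma ae_le_sum_excess_m' {t d : ℝ} (ht : M.G' t = t) (hd : d < t) :
    ∃ D : ℝ, 0 ≤ D ∧ ∀ᵐ ω ∂M.law, ∃ C : ℝ, ∀ N n : ℕ, N + D * Real.log (N + 1) ≤ n →
      C ≤ ∑ k ∈ Finset.Ico N n, M.excess d (M.m' d) (ω k) := by
  have hm := M.measurable_m' d
  obtain ⟨s, hs, hexp⟩ := exists_integrable_exp_abs_excess (M := M) d hm
  obtain ⟨D, hD, h⟩ := ae_exists_bound_sum_Ico (Z := fun l => -M.excess d (M.m' d) l)
    (measurable_excess d hm).neg hs (by simpa only [abs_neg] using hexp) (by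
      rw [integral_neg, integral_excess d hm]
      exact neg_neg_of_pos (mul_pos (by linarith [le_H_of_G'_eq ht hm])
        (integral_negLogA_selection_pos hm)))
  refine ⟨D, hD, h.mono fun ω hω => ?_⟩
  obtain ⟨C, hC⟩ := hω
  refine ⟨-C, fun N n hn => ?_⟩
  have := hC N n hn
  rw [Finset.sum_neg_distrib] at this
  linarith

theorem ae_upperPhiDim_eq {t : ℝ} (h0 : 0 ≤ t) (ht : M.G t = t) {Φ : ℝ → ℝ}
    (hΦ : IsLargeDimensionFunction Φ) :
    ∀ᵐ ω ∂M.law, upperPhiDim Φ (M.moranMeasure ω) = t := by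
  have hadm : ∀ᵐ ω ∂M.law, ∀ q : {q : ℚ // t < q},
      upperPhiDim Φ (M.moranMeasure ω) ≤ ((q.1 : ℝ) : EReal) := by
    refine ae_all_iff.2 fun q => ?_
    obtain ⟨D, hD, h⟩ := ae_sum_excess_m_le ht q.2
    filter_upwards [h, M.ae_law_p_pos] with ω ⟨C, hC⟩ hp
    exact sInf_le ⟨q.1, exists_upper_bound_of_sum_le hΦ hp (h0.trans q.2.le) hD hC, rfl⟩
  -- `t` is the value of `H` at the selection `m t`
  filter_upwards [hadm, M.ae_law_p_pos, ae_tendsto_sum_excess (M.measurable_m t)] with ω hω hp hs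
  refine le_antisymm (EReal.le_of_forall_lt_iff_le.1 fun z hz => ?_) (le_sInf ?_)
  · obtain ⟨q, hq, hqz⟩ := exists_rat_btwn (EReal.coe_lt_coe_iff.1 hz)
    exact (hω ⟨q, hq⟩).trans (EReal.coe_le_coe_iff.2 hqz.le)
  · rintro _ ⟨d, hd, rfl⟩
    refine EReal.coe_le_coe_iff.2 (not_lt.1 fun hdt => ?_)
    exact not_exists_upper_bound hΦ.toIsDimensionFunction hp
      (hs.1 d (hdt.trans_eq ht.symm)) hd

theorem ae_lowerPhiDim_eq {t : ℝ} (ht : M.G' t = t) {Φ : ℝ → ℝ}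
    (hΦ : IsLargeDimensionFunction Φ) :
    ∀ᵐ ω ∂M.law, lowerPhiDim Φ (M.moranMeasure ω) = t := by
  have hadm : ∀ᵐ ω ∂M.law, ∀ q : {q : ℚ // (q : ℝ) < t},
      ((q.1 : ℝ) : EReal) ≤ lowerPhiDim Φ (M.moranMeasure ω) := by
    refine ae_all_iff.2 fun q => ?_
    rcases le_total ((q.1 : ℚ) : ℝ) 0 with hq | hq
    · filter_upwards [M.ae_law_p_pos] with ω hp
      exact le_sSup ⟨q.1, exists_lower_bound_of_neg Φ hp hq, rfl⟩
    · obtain ⟨D, hD, h⟩ := ae_le_sum_excess_m' ht q.2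
      filter_upwards [h, M.ae_law_p_pos] with ω ⟨C, hC⟩ hp
      exact le_sSup ⟨q.1, exists_lower_bound_of_le_sum hΦ hp hq hD hC, rfl⟩
  -- `t` is the value of `H` at the selection for the minimum
  filter_upwards [hadm, M.ae_law_p_pos, ae_tendsto_sum_excess (M.measurable_m' t)] with ω hω hp hs
  refine le_antisymm (sSup_le ?_) (EReal.ge_of_forall_gt_iff_ge.1 fun z hz => ?_)
  · rintro _ ⟨d, hd, rfl⟩
    refine EReal.coe_le_coe_iff.2 (not_lt.1 fun hdt => ?_)
    exact not_exists_lower_bound hΦ.toIsDimensionFunction hp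
      (hs.2 d (ht.trans_lt hdt)) hd
  · obtain ⟨q, hzq, hq⟩ := exists_rat_btwn (EReal.coe_lt_coe_iff.1 hz)
    exact (EReal.coe_le_coe_iff.2 hzq.le).trans (hω ⟨q, hq⟩)

end RandomMoranModel

end

theorem mainTheorem8 {K : ℕ} {𝒜 𝒲 : Type*} [MeasurableSpace 𝒜] [MeasurableSpace 𝒲]
    (M : RandomMoranModel K 𝒜 𝒲) :
    (M.supH = M.supG ∧
      ∀ Φ : ℝ → ℝ, IsLargeDimensionFunction Φ →
        ∀ᵐ ω ∂M.law, upperPhiDim Φ (M.moranMeasure ω) = M.supG) ∧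
    (∀ t : ℝ, (t : EReal) = M.supH ↔ 0 ≤ t ∧ M.G t = t) ∧
    (M.infH = M.infG' ∧
      ∀ Φ : ℝ → ℝ, IsLargeDimensionFunction Φ →
        ∀ᵐ ω ∂M.law, lowerPhiDim Φ (M.moranMeasure ω) = M.infG') ∧
    (∀ t : ℝ, (t : EReal) = M.infH ↔ 0 ≤ t ∧ M.G' t = t) ∧
    (∃! t : ℝ, 0 ≤ t ∧ M.G t = t) ∧
    (∃! t : ℝ, 0 ≤ t ∧ M.G' t = t) := by
  obtain ⟨t, ⟨h0, ht⟩, huniq⟩ := M.existsUnique_G_eq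
  obtain ⟨t', ⟨h0', ht'⟩, huniq'⟩ := M.existsUnique_G'_eq
  rw [RandomMoranModel.supH_eq ht, RandomMoranModel.supG_eq h0 ht, RandomMoranModel.infH_eq ht',
    RandomMoranModel.infG'_eq h0' ht']
  refine ⟨⟨rfl, fun Φ hΦ => RandomMoranModel.ae_upperPhiDim_eq h0 ht hΦ⟩, fun s => ?_,
    ⟨rfl, fun Φ hΦ => RandomMoranModel.ae_lowerPhiDim_eq ht' hΦ⟩, fun s => ?_,
    ⟨t, ⟨h0, ht⟩, huniq⟩, ⟨t', ⟨h0', ht'⟩, huniq'⟩⟩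
  · rw [EReal.coe_eq_coe_iff]
    exact ⟨fun h => h ▸ ⟨h0, ht⟩, huniq s⟩
  · rw [EReal.coe_eq_coe_iff]
    exact ⟨fun h => h ▸ ⟨h0', ht'⟩, huniq' s⟩
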